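/- A \emph{spacetime} is a connected Hausdorff smooth manifold without boundary of dimension $n\ge 2$ with a smooth Lorentzian metric of signature $(-,+,\dots,+)$ and a time orientation. Timelike and causal curves are $C^1$ curves whose tangent vectors are everywhere nonzero, future directed and timelike (respectively timelike or lightlike). For a subset $S$ of a spacetime $M$, let $D^+(S)$ be the set of points $p\in M$ such that every past inextendible causal curve with future endpoint $p$ (that is, every causal curve $\gamma:(a,b]\to M$ with $\gamma(b)=p$ for which $\lim_{t\to a^+}\gamma(t)$ does not exist in $M$) intersects $S$; let $D^-(S)$ be the dual set, defined with future inextendible causal curves with past endpoint $p$; and let $D(S)=D^+(S)\cup D^-(S)$. The sets $\tilde D^{\pm}(S)$ and $\tilde D(S)=\tilde D^+(S)\cup\tilde D^-(S)$ are defined in the same way with timelike instead of causal curves. A set is \emph{achronal} if no two of its points (distinct or not) are joined by a timelike curve. Let $M$ and $N$ be spacetimes of the same dimension. An \emph{isometry} $\varphi:A\to N$ defined on a subset $A\subset M$ is an injective, not necessarily surjective, map which near each point of $A$ is the restriction of a smooth map, defined on an open subset of $M$, whose differential preserves the metric at every point of $A$ in that open subset. \textbf{Proposition.} Let $S\subset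 M$ be a closed achronal set and let $\varphi:\tilde D(S)\to N$ be an isometry. Then $$\varphi(D(S))\subset D(\varphi(S))\qquad\text{and}\qquad \varphi(\tilde D(S))\subset\tilde D(\varphi(S)).$$ -/

import Mathlib

open Set Filter Topology
open scoped Manifold ContDiff

/-- A smooth time-oriented Lorentzian structure on an `n`-dimensional smooth manifold `M` (without
boundary): a smooth symmetric bilinear form on the tangent spaces, of signature `(-, +, …, +)`,
together with a continuous timelike vector field, which fixes the time orientation. -/
structure LorentzStructure (n : ℕ) (M : Type*) [TopologicalSpace M]
    [ChartedSpace (EuclideanSpace ℝ (Fin n)) M] [IsManifold (𝓡 n) ∞ M] where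
  /-- The metric tensor. -/
  metric : ∀ x : M, TangentSpace (𝓡 n) x →L[ℝ] TangentSpace (𝓡 n) x →L[ℝ] ℝ
  symm : ∀ (x : M) (v w : TangentSpace (𝓡 n) x), metric x v w = metric x w v
  /-- At each point there is an orthonormal basis with exactly one timelike vector. -/
  signature : ∀ x : M, ∃ b : Module.Basis (Fin n) ℝ (TangentSpace (𝓡 n) x),
    ∀ i j : Fin n, metric x (b i) (b j) =
      if i = j then (if (i : ℕ) = 0 then -1 else 1) else 0
  smooth : ContMDiff (𝓡 n)
    ((𝓡 n).prod 𝓘(ℝ, EuclideanSpace ℝ (Fin n) →L[ℝ] EuclideanSpace ℝ (Fin n) →L[ℝ] ℝ)) ∞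
    (fun x ↦ Bundle.TotalSpace.mk'
      (EuclideanSpace ℝ (Fin n) →L[ℝ] EuclideanSpace ℝ (Fin n) →L[ℝ] ℝ)
      (E := fun y : M ↦ TangentSpace (𝓡 n) y →L[ℝ] TangentSpace (𝓡 n) y →L[ℝ] ℝ) x (metric x))
  /-- The vector field that fixes the time orientation: it points to the future. -/
  timeField : ∀ x : M, TangentSpace (𝓡 n) x
  timeField_continuous : Continuous (fun x ↦ (⟨x, timeField x⟩ : TangentBundle (𝓡 n) M))
  timeField_timelike : ∀ x : M, metric x (timeField x) (timeField x) < 0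

namespace LorentzStructure

variable {n : ℕ} {M : Type*} [TopologicalSpace M]
  [ChartedSpace (EuclideanSpace ℝ (Fin n)) M] [IsManifold (𝓡 n) ∞ M]

/-- `v` is a future directed timelike vector at `x`. -/
def FutureTimelike (g : LorentzStructure n M) (x : M) (v : TangentSpace (𝓡 n) x) : Prop :=
  g.metric x v v < 0 ∧ g.metric x (g.timeField x) v < 0

/-- `v` is a future directed causal (timelike or lightlike, nonzero) vector at `x`. -/
def FutureCausal (g : LorentzStructure n M) (x : M) (v : TangentSpace (𝓡 n) x) : Prop :=
  v ≠ 0 ∧ g.metric x v v ≤ 0 ∧ g.metric x (g.timeField x) v < 0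

/-- The restriction of `γ` to the interval `J` is a future directed `C¹` timelike curve. -/
def IsTimelikeCurveOn (g : LorentzStructure n M) (γ : ℝ → M) (J : Set ℝ) : Prop :=
  ContMDiffOn 𝓘(ℝ, ℝ) (𝓡 n) 1 γ J ∧
    ∀ t ∈ J, g.FutureTimelike (γ t) (mfderivWithin 𝓘(ℝ, ℝ) (𝓡 n) γ J t (1 : ℝ))

/-- The restriction of `γ` to the interval `J` is a future directed `C¹` causal curve. -/
def IsCausalCurveOn (g : LorentzStructure n M) (γ : ℝ → M) (J : Set ℝ) : Prop :=
  ContMDiffOn 𝓘(ℝ, ℝ) (𝓡 n) 1 γ J ∧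
    ∀ t ∈ J, g.FutureCausal (γ t) (mfderivWithin 𝓘(ℝ, ℝ) (𝓡 n) γ J t (1 : ℝ))

/-- No two points of `S` are joined by a timelike curve. -/
def IsAchronal (g : LorentzStructure n M) (S : Set M) : Prop :=
  ∀ (a b : ℝ) (γ : ℝ → M), a < b → g.IsTimelikeCurveOn γ (Icc a b) → γ a ∈ S → γ b ∉ S

/-- The curve `γ`, defined to the right of `a`, has no endpoint at `a`. -/
def PastInextendible (γ : ℝ → M) (a : ℝ) : Prop :=
  ¬ ∃ x : M, Tendsto γ (𝓝[>] a) (𝓝 x)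

/-- The curve `γ`, defined to the left of `b`, has no endpoint at `b`. -/
def FutureInextendible (γ : ℝ → M) (b : ℝ) : Prop :=
  ¬ ∃ x : M, Tendsto γ (𝓝[<] b) (𝓝 x)

/-- `D⁺(S)`: the points `p` such that every past inextendible causal curve `γ : (a, b] → M` with
future endpoint `p` meets `S`. -/
def futureDomain (g : LorentzStructure n M) (S : Set M) : Set M :=
  {p | ∀ (a b : ℝ) (γ : ℝ → M), a < b → g.IsCausalCurveOn γ (Ioc a b) →
    PastInextendible γ a → γ b = p → ∃ t ∈ Ioc a b, γ t ∈ S}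

/-- `D⁻(S)`: the points `p` such that every future inextendible causal curve `γ : [a, b) → M` with
past endpoint `p` meets `S`. -/
def pastDomain (g : LorentzStructure n M) (S : Set M) : Set M :=
  {p | ∀ (a b : ℝ) (γ : ℝ → M), a < b → g.IsCausalCurveOn γ (Ico a b) →
    FutureInextendible γ b → γ a = p → ∃ t ∈ Ico a b, γ t ∈ S}

/-- The domain of dependence `D(S) = D⁺(S) ∪ D⁻(S)`. -/
def domainOfDependence (g : LorentzStructure n M) (S : Set M) : Set M :=
  g.futureDomain S ∪ g.pastDomain S

/-- `D̃⁺(S)`: as `D⁺(S)`, with timelike instead of causal curves. -/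
def futureTimelikeDomain (g : LorentzStructure n M) (S : Set M) : Set M :=
  {p | ∀ (a b : ℝ) (γ : ℝ → M), a < b → g.IsTimelikeCurveOn γ (Ioc a b) →
    PastInextendible γ a → γ b = p → ∃ t ∈ Ioc a b, γ t ∈ S}

/-- `D̃⁻(S)`: as `D⁻(S)`, with timelike instead of causal curves. -/
def pastTimelikeDomain (g : LorentzStructure n M) (S : Set M) : Set M :=
  {p | ∀ (a b : ℝ) (γ : ℝ → M), a < b → g.IsTimelikeCurveOn γ (Ico a b) →
    FutureInextendible γ b → γ a = p → ∃ t ∈ Ico a b, γ t ∈ S}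

/-- The timelike domain of dependence `D̃(S) = D̃⁺(S) ∪ D̃⁻(S)`. -/
def timelikeDomainOfDependence (g : LorentzStructure n M) (S : Set M) : Set M :=
  g.futureTimelikeDomain S ∪ g.pastTimelikeDomain S

/-- The restriction of `φ` to `A` is an isometry `A → N` (not necessarily surjective): it is
injective, and near each point of `A` it extends to a smooth map on an open set of `M` whose
differential preserves the metric at the points of `A`. For open `A` this says that `φ` is
injective and smooth on `A` and pulls the metric of `N` back to that of `M`. -/
def IsIsometryOn {N : Type*} [TopologicalSpace N]
    [ChartedSpace (EuclideanSpace ℝ (Fin n)) N] [IsManifold (𝓡 n) ∞ N]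
    (g : LorentzStructure n M) (h : LorentzStructure n N) (φ : M → N) (A : Set M) : Prop :=
  InjOn φ A ∧
    ∀ x ∈ A, ∃ (U : Set M) (Φ : M → N), IsOpen U ∧ x ∈ U ∧
      ContMDiffOn (𝓡 n) (𝓡 n) ∞ Φ U ∧ EqOn Φ φ (A ∩ U) ∧
      ∀ y ∈ A ∩ U, ∀ v w : TangentSpace (𝓡 n) y,
        h.metric (Φ y) (mfderiv (𝓡 n) (𝓡 n) Φ y v) (mfderiv (𝓡 n) (𝓡 n) Φ y w) =
          g.metric y v w

end LorentzStructure

/-! Let `p ∈ D̃⁺(S)` and suppose that the differential of the isometry at `p` preserves the time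
orientation. If a past inextendible causal curve `γ` ending at `φ p` missed `φ(S)`, lift it to `δ =
φ⁻¹ ∘ γ` on the largest interval `(c, b]` on which this is a causal curve in `D̃⁺(S)`. Once `δ` is
known to be past inextendible, it meets `S` because `p` lies in the domain of dependence, so `γ`
meets `φ(S)`: a contradiction. The lift keeps the speed of `γ`, so the same argument serves timelike
curves.

It remains to see that `δ` has no limit at `c` (`exists_inextendible_lift`). A limit `x` lies in
`D̃⁺(S)`, which is closed (`isClosed_futureTimelikeDomain`), and `γ` tends to `φ x`. This excludes
`c = a`; for `c > a` the lift can be continued to the left of `c` (`exists_liftAt_left`), against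
maximality.

The difficulty is that `x` may be a boundary point of `D̃⁺(S)`. There `φ` is the restriction of a
smooth map `Φ` that is isometric only at points of `D̃⁺(S)`. Inverting `Φ` locally turns `γ` into a
curve `u` ending at `x`, causal for the pull-back `Φ^*h`, but `u` might leave the set where `Φ^*h =
g`. `eventually_mem_futureTimelikeDomain` excludes this. With the end of `u` at parameter `b`, the
curve `u(t) - s(b - t)T`, where `T` is future timelike at `x` and `s > 0` is small, is strictly
timelike for `Φ^*h` near its end. Follow it backwards from `x`: wherever it is in `D̃⁺(S)` it is
timelike for `g`, hence also slightly earlier, and a timelike curve running into the past from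
`D̃⁺(S)` without meeting `S` stays in `D̃⁺(S)` (`mem_futureTimelikeDomain_of_curve`). So the
perturbed curve never leaves `D̃⁺(S)`, and `s → 0` gives the same for `u`.

Reversing the time orientation of `M` exchanges `D⁺` and `D⁻`; reversing that of `N` handles the
points where the differential reverses the orientation. -/

section LorentzAlgebra

/-! ### Linear algebra of Lorentz forms -/

variable {n : ℕ} {V : Type*} [AddCommGroup V] [Module ℝ V] {B : V →ₗ[ℝ] V →ₗ[ℝ] ℝ}

/-- The bilinear form `B` has signature `(-, +, …, +)`. -/
def IsLorentzForm (n : ℕ) (B : V →ₗ[ℝ] V →ₗ[ℝ] ℝ) : Prop :=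
  (∀ v w, B v w = B w v) ∧ ∃ b : Module.Basis (Fin n) ℝ V, ∀ i j : Fin n,
    B (b i) (b j) = if i = j then (if (i : ℕ) = 0 then -1 else 1) else 0

theorem IsLorentzForm.apply_eq {m : ℕ} {b : Module.Basis (Fin (m + 1)) ℝ V}
    (hb : ∀ i j : Fin (m + 1),
      B (b i) (b j) = if i = j then (if (i : ℕ) = 0 then -1 else 1) else 0) (v w : V) :
    B v w = -(b.repr v 0 * b.repr w 0) + ∑ i : Fin m, b.repr v i.succ * b.repr w i.succ := by
  conv_lhs => rw [← b.sum_repr v, ← b.sum_repr w]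
  simp only [map_sum, map_smul, LinearMap.sum_apply, LinearMap.smul_apply, hb, smul_eq_mul,
    mul_ite, mul_zero, Finset.sum_ite_eq', Finset.mem_univ, if_true]
  rw [Fin.sum_univ_succ]
  simp [mul_comm]

/-- Reverse Cauchy–Schwarz. Orthogonality would make the product of the time components equal to the
inner product of the space parts, whose square is at most the product of the squared norms; this is
too small, since `T` is strictly timelike and `w` has nonzero time component. -/
theorem IsLorentzForm.pairing_ne_zero (hB : IsLorentzForm n B) {T w : V} (hT : B T T < 0)
    (hw : B w w ≤ 0) (hw0 : w ≠ 0) : B T w ≠ 0 := by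
  obtain ⟨-, b, hb⟩ := hB
  cases n with
  | zero =>
    exact absurd (b.repr.injective (Subsingleton.elim _ _)) hw0
  | succ m =>
    rw [IsLorentzForm.apply_eq hb] at hT hw ⊢
    intro h
    have cs := Finset.sum_mul_sq_le_sq_mul_sq Finset.univ
      (fun i : Fin m ↦ b.repr T i.succ) (fun i : Fin m ↦ b.repr w i.succ)
    have e : ∀ v : V, ∑ i : Fin m, b.repr v i.succ * b.repr v i.succ
        = ∑ i : Fin m, b.repr v i.succ ^ 2 := fun v ↦
      Finset.sum_congr rfl fun i _ ↦ (sq _).symm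
    rw [e] at hT hw
    have hT0 : 0 ≤ ∑ i : Fin m, b.repr T i.succ ^ 2 := Finset.sum_nonneg fun _ _ ↦ sq_nonneg _
    have hw1 : 0 ≤ ∑ i : Fin m, b.repr w i.succ ^ 2 := Finset.sum_nonneg fun _ _ ↦ sq_nonneg _
    have hw2 : b.repr w 0 ≠ 0 := by
      intro h0
      rw [h0] at hw
      have h1 : ∑ i : Fin m, b.repr w i.succ ^ 2 = 0 := le_antisymm (by linarith) hw1
      rw [Finset.sum_eq_zero_iff_of_nonneg fun _ _ ↦ sq_nonneg _] at h1
      apply hw0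
      apply b.repr.injective
      ext i
      refine Fin.cases ?_ (fun j ↦ ?_) i
      · simpa using h0
      · simpa using h1 j (Finset.mem_univ _)
    have hpos : 0 < b.repr w 0 ^ 2 := by positivity
    have h3 : (b.repr T 0 * b.repr w 0) ^ 2 ≤
        (∑ i : Fin m, b.repr T i.succ ^ 2) * ∑ i : Fin m, b.repr w i.succ ^ 2 := by
      refine le_trans (le_of_eq ?_) cs
      congr 1
      linarith
    nlinarith [mul_nonneg hT0 (sub_nonneg.2 hw : (0:ℝ) ≤ 0 - _)]

theorem IsLorentzForm.nondegenerate (hB : IsLorentzForm n B) {v : V} (h : ∀ w, B v w = 0) :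
    v = 0 := by
  obtain ⟨-, b, hb⟩ := hB
  apply b.repr.injective
  ext i
  have h1 := h (b i)
  rw [← b.sum_repr v] at h1
  simp only [map_sum, map_smul, LinearMap.sum_apply, LinearMap.smul_apply, hb, smul_eq_mul,
    mul_ite, mul_zero, Finset.sum_ite_eq', Finset.mem_univ, if_true] at h1
  split_ifs at h1 <;> simpa using h1

/-- All vectors on the segment from `T` to `u` are timelike, because the cross term `B T u` is
negative. If `B u w` were nonnegative, the pairing with `w` would vanish somewhere on the segment,
at the parameter `s`, against `pairing_ne_zero`. -/
theorem IsLorentzForm.same_orientation (hB : IsLorentzForm n B) {T u w : V} (hT : B T T < 0)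
    (hu : B u u < 0) (huT : B T u < 0) (hw : B w w ≤ 0) (hw0 : w ≠ 0) (hTw : B T w < 0) :
    B u w < 0 := by
  by_contra! hcon
  set s : ℝ := B T w / (B T w - B u w) with hs
  have hden : B T w - B u w < 0 := by linarith
  have hs0 : 0 < s := div_pos_of_neg_of_neg hTw hden
  have hs1 : s ≤ 1 := by
    rw [hs, div_le_one_of_neg hden]; linarith
  have hsym := hB.1 u T
  have hne := hB.pairing_ne_zero (T := (1 - s) • T + s • u) (w := w) ?_ hw hw0
  · apply hne
    simp only [map_add, map_smul, LinearMap.add_apply, LinearMap.smul_apply, smul_eq_mul]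
    have : s * (B T w - B u w) = B T w := div_mul_cancel₀ _ hden.ne
    linarith
  · simp only [map_add, map_smul, LinearMap.add_apply, LinearMap.smul_apply, smul_eq_mul, hsym]
    nlinarith [mul_pos hs0 hs0, mul_nonneg (sub_nonneg.2 hs1) hs0.le,
      mul_nonneg (sub_nonneg.2 hs1) (sub_nonneg.2 hs1)]

theorem IsLorentzForm.convex_timelike (hB : IsLorentzForm n B) {T v w : V} (hT : B T T < 0)
    (hv : B v v < 0) (hTv : B T v < 0) (hw : B w w < 0) (hTw : B T w < 0) {s : ℝ} (hs0 : 0 ≤ s)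
    (hs1 : s ≤ 1) :
    B ((1 - s) • v + s • w) ((1 - s) • v + s • w) < 0 ∧ B T ((1 - s) • v + s • w) < 0 := by
  have hw0 : w ≠ 0 := by
    rintro rfl
    simp at hw
  have hvw := hB.same_orientation hT hv hTv hw.le hw0 hTw
  have hsym := hB.1 w v
  simp only [map_add, map_smul, LinearMap.add_apply, LinearMap.smul_apply, smul_eq_mul, hsym]
  rcases hs0.eq_or_lt with rfl | h
  · simp [hv, hTv]
  · constructor
    · nlinarith [mul_pos h h, mul_nonneg (sub_nonneg.2 hs1) hs0,
        mul_nonneg (sub_nonneg.2 hs1) (sub_nonneg.2 hs1)]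
    · nlinarith

end LorentzAlgebra

/-! ### The metric and the time orientation pulled back to coordinates -/

namespace LorentzStructure

variable {n : ℕ} {M : Type*} [TopologicalSpace M]
  [ChartedSpace (EuclideanSpace ℝ (Fin n)) M] [IsManifold (𝓡 n) ∞ M]

/-- The metric at `x` as an algebraic bilinear form. -/
noncomputable def form (g : LorentzStructure n M) (x : M) :
    TangentSpace (𝓡 n) x →ₗ[ℝ] TangentSpace (𝓡 n) x →ₗ[ℝ] ℝ :=
  LinearMap.mk₂ ℝ (fun v w ↦ g.metric x v w) (by simp) (by simp) (by simp) (by simp)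

@[simp] theorem form_apply (g : LorentzStructure n M) (x : M) (v w : TangentSpace (𝓡 n) x) :
    g.form x v w = g.metric x v w := rfl

theorem isLorentzForm (g : LorentzStructure n M) (x : M) : IsLorentzForm n (g.form x) :=
  ⟨g.symm x, g.signature x⟩

/-- The pull-back of the metric under a map `F`, as a quadratic form in `v`. -/
noncomputable def pullQuad (g : LorentzStructure n M) (F : EuclideanSpace ℝ (Fin n) → M)
    (p : EuclideanSpace ℝ (Fin n) × EuclideanSpace ℝ (Fin n)) : ℝ :=
  g.metric (F p.1) (mfderiv (𝓡 n) (𝓡 n) F p.1 p.2) (mfderiv (𝓡 n) (𝓡 n) F p.1 p.2)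

/-- The pairing of the time orientation with the image of `v` under the differential of `F`. -/
noncomputable def pullTime (g : LorentzStructure n M) (F : EuclideanSpace ℝ (Fin n) → M)
    (p : EuclideanSpace ℝ (Fin n) × EuclideanSpace ℝ (Fin n)) : ℝ :=
  g.metric (F p.1) (g.timeField (F p.1)) (mfderiv (𝓡 n) (𝓡 n) F p.1 p.2)

/-- The order `k` is left free because the time field is only continuous: `k = 0` is used for
pairings with it, `k = ∞` for the pulled-back metric. -/
theorem contMDiffWithinAt_metric_apply (g : LorentzStructure n M) {k : WithTop ℕ∞} (hk : k ≤ ∞)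
    {EM : Type*} [NormedAddCommGroup EM] [NormedSpace ℝ EM]
    {f : EM → M} {v w : ∀ x, TangentSpace (𝓡 n) (f x)} {s : Set EM} {x : EM}
    (hv : ContMDiffWithinAt 𝓘(ℝ, EM) (𝓡 n).tangent k
      (fun m ↦ (⟨f m, v m⟩ : TangentBundle (𝓡 n) M)) s x)
    (hw : ContMDiffWithinAt 𝓘(ℝ, EM) (𝓡 n).tangent k
      (fun m ↦ (⟨f m, w m⟩ : TangentBundle (𝓡 n) M)) s x) :
    ContMDiffWithinAt 𝓘(ℝ, EM) 𝓘(ℝ, ℝ) k (fun m ↦ g.metric (f m) (v m) (w m)) s x := by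
  have hb : ContMDiffWithinAt 𝓘(ℝ, EM) (𝓡 n) k f s x := by
    simp only [Bundle.contMDiffWithinAt_totalSpace] at hv
    exact hv.1
  have : IsManifold (𝓡 n) (∞ + 1) M := ‹IsManifold (𝓡 n) ∞ M›
  have : IsManifold (𝓡 n) (k + 1) M := IsManifold.of_le (n := ∞ + 1) (by gcongr)
  have : ContMDiffWithinAt 𝓘(ℝ, EM) ((𝓡 n).prod 𝓘(ℝ)) k
      (fun m ↦ Bundle.TotalSpace.mk' ℝ (E := Bundle.Trivial M ℝ) (f m)
        (g.metric (f m) (v m) (w m))) s x := by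
    apply ContMDiffWithinAt.clm_bundle_apply₂ (F₁ := EuclideanSpace ℝ (Fin n))
      (F₂ := EuclideanSpace ℝ (Fin n))
    · exact ContMDiffAt.comp_contMDiffWithinAt x (g.smooth.contMDiffAt.of_le hk) hb
    · exact hv
    · exact hw
  simp only [Bundle.contMDiffWithinAt_totalSpace] at this
  exact this.2

theorem contMDiffOn_tangent_pair {F : EuclideanSpace ℝ (Fin n) → M}
    {W : Set (EuclideanSpace ℝ (Fin n))} (hW : IsOpen W) (hF : ContMDiffOn (𝓡 n) (𝓡 n) ∞ F W) :
    ContMDiffOn 𝓘(ℝ, EuclideanSpace ℝ (Fin n) × EuclideanSpace ℝ (Fin n)) (𝓡 n).tangent ∞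
      (fun p : EuclideanSpace ℝ (Fin n) × EuclideanSpace ℝ (Fin n) ↦
        (⟨F p.1, mfderiv (𝓡 n) (𝓡 n) F p.1 p.2⟩ : TangentBundle (𝓡 n) M)) (W ×ˢ univ) := by
  have h1 := hF.contMDiffOn_tangentMapWithin (m := ∞) (by simp) hW.uniqueMDiffOn
  have h2 : ContMDiff 𝓘(ℝ, EuclideanSpace ℝ (Fin n) × EuclideanSpace ℝ (Fin n)) (𝓡 n).tangent ∞
      (fun p : EuclideanSpace ℝ (Fin n) × EuclideanSpace ℝ (Fin n) ↦
        (⟨p.1, p.2⟩ : TangentBundle (𝓡 n) (EuclideanSpace ℝ (Fin n)))) := by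
    intro p
    rw [Bundle.contMDiffAt_totalSpace]
    refine ⟨contDiff_fst.contMDiff.contMDiffAt, ?_⟩
    have : ContMDiffAt 𝓘(ℝ, EuclideanSpace ℝ (Fin n) × EuclideanSpace ℝ (Fin n)) (𝓡 n) ∞
        (Prod.snd : EuclideanSpace ℝ (Fin n) × EuclideanSpace ℝ (Fin n) → _) p :=
      contDiff_snd.contMDiff.contMDiffAt
    refine this.congr_of_eventuallyEq (Eventually.of_forall fun q ↦ ?_)
    exact congrArg Prod.snd (trivializationAt_model_space_apply (I := 𝓡 n) _ _)
  have h3 := h1.comp (h2.contMDiffOn (s := W ×ˢ univ)) (fun p hp ↦ hp.1)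
  refine h3.congr fun p hp ↦ ?_
  change _ = tangentMapWithin (𝓡 n) (𝓡 n) F W ⟨p.1, p.2⟩
  simp only [tangentMapWithin]
  rw [mfderivWithin_of_isOpen hW hp.1]

theorem contDiffOn_pullQuad (g : LorentzStructure n M) {F : EuclideanSpace ℝ (Fin n) → M}
    {W : Set (EuclideanSpace ℝ (Fin n))} (hW : IsOpen W) (hF : ContMDiffOn (𝓡 n) (𝓡 n) ∞ F W) :
    ContDiffOn ℝ ∞ (g.pullQuad F) (W ×ˢ univ) := by
  rw [← contMDiffOn_iff_contDiffOn]
  intro p hp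
  have h := contMDiffOn_tangent_pair hW hF p hp
  exact g.contMDiffWithinAt_metric_apply le_rfl h h

theorem continuousOn_pullTime (g : LorentzStructure n M) {F : EuclideanSpace ℝ (Fin n) → M}
    {W : Set (EuclideanSpace ℝ (Fin n))} (hW : IsOpen W) (hF : ContMDiffOn (𝓡 n) (𝓡 n) ∞ F W) :
    ContinuousOn (g.pullTime F) (W ×ˢ univ) := by
  have hT : ContMDiffOn 𝓘(ℝ, EuclideanSpace ℝ (Fin n) × EuclideanSpace ℝ (Fin n)) (𝓡 n).tangent 0
      (fun p : EuclideanSpace ℝ (Fin n) × EuclideanSpace ℝ (Fin n) ↦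
        (⟨F p.1, g.timeField (F p.1)⟩ : TangentBundle (𝓡 n) M)) (W ×ˢ univ) := by
    rw [contMDiffOn_zero_iff]
    exact g.timeField_continuous.comp_continuousOn
      (hF.continuousOn.comp continuousOn_fst fun p hp ↦ hp.1)
  have h : ContMDiffOn 𝓘(ℝ, EuclideanSpace ℝ (Fin n) × EuclideanSpace ℝ (Fin n)) 𝓘(ℝ, ℝ) 0
      (g.pullTime F) (W ×ˢ univ) := fun p hp ↦
    g.contMDiffWithinAt_metric_apply (by simp) (hT p hp)
      ((contMDiffOn_tangent_pair hW hF p hp).of_le (by simp))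
  exact h.continuousOn

end LorentzStructure

/-! ### Curves, their velocities, and the cone of future timelike vectors -/

namespace LorentzStructure

variable {n : ℕ} {M : Type*} [TopologicalSpace M]
  [ChartedSpace (EuclideanSpace ℝ (Fin n)) M]

/-- `γ` is `C¹` at `t` within `J`, and its velocity satisfies `P`. -/
def IsCurveAt (P : ∀ x : M, TangentSpace (𝓡 n) x → Prop) (γ : ℝ → M) (J : Set ℝ) (t : ℝ) : Prop :=
  ContMDiffWithinAt 𝓘(ℝ, ℝ) (𝓡 n) 1 γ J t ∧
    P (γ t) (mfderivWithin 𝓘(ℝ, ℝ) (𝓡 n) γ J t (1 : ℝ))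

theorem IsCurveAt.congr {P : ∀ x : M, TangentSpace (𝓡 n) x → Prop} {γ γ' : ℝ → M} {J J' : Set ℝ}
    {t : ℝ} (h : IsCurveAt P γ' J' t) (hγ : γ =ᶠ[𝓝[J] t] γ') (ht : t ∈ J) (hJ : J =ᶠ[𝓝 t] J') :
    IsCurveAt P γ J t := by
  have hγt : γ t = γ' t := hγ.self_of_nhdsWithin ht
  obtain ⟨h1, h2⟩ := h
  have h3 : ContMDiffWithinAt 𝓘(ℝ, ℝ) (𝓡 n) 1 γ' J t := by
    rwa [contMDiffWithinAt_congr_set hJ]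
  refine ⟨h3.congr_of_eventuallyEq hγ hγt, ?_⟩
  rw [← mfderivWithin_congr_set hJ] at h2
  rw [hγ.mfderivWithin_eq hγt]
  -- The velocities of the two curves live in tangent spaces at points that are only provably equal;
  -- both spaces are the same model space, so the vector can be carried over.
  have key : ∀ (x y : M) (v : EuclideanSpace ℝ (Fin n)), x = y → P y v → P x v := by
    rintro x y v rfl hv
    exact hv
  exact key _ _ _ hγt h2

variable [IsManifold (𝓡 n) ∞ M]

theorem isTimelikeCurveOn_iff {g : LorentzStructure n M} {γ : ℝ → M} {J : Set ℝ} :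
    g.IsTimelikeCurveOn γ J ↔ ∀ t ∈ J, IsCurveAt g.FutureTimelike γ J t :=
  ⟨fun h t ht ↦ ⟨h.1 t ht, h.2 t ht⟩, fun h ↦ ⟨fun t ht ↦ (h t ht).1, fun t ht ↦ (h t ht).2⟩⟩

theorem isCausalCurveOn_iff {g : LorentzStructure n M} {γ : ℝ → M} {J : Set ℝ} :
    g.IsCausalCurveOn γ J ↔ ∀ t ∈ J, IsCurveAt g.FutureCausal γ J t :=
  ⟨fun h t ht ↦ ⟨h.1 t ht, h.2 t ht⟩, fun h ↦ ⟨fun t ht ↦ (h t ht).1, fun t ht ↦ (h t ht).2⟩⟩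

omit [IsManifold (𝓡 n) ∞ M] in
theorem mfderivWithin_comp_curve {F : EuclideanSpace ℝ (Fin n) → M}
    {W : Set (EuclideanSpace ℝ (Fin n))} (hW : IsOpen W) (hF : ContMDiffOn (𝓡 n) (𝓡 n) ∞ F W)
    {f : ℝ → EuclideanSpace ℝ (Fin n)} {f' : EuclideanSpace ℝ (Fin n)} {J : Set ℝ} {t : ℝ}
    (hf' : HasDerivWithinAt f f' J t) (hJ : UniqueDiffWithinAt ℝ J t) (ht : f t ∈ W) :
    mfderivWithin 𝓘(ℝ, ℝ) (𝓡 n) (fun s ↦ F (f s)) J t (1 : ℝ) =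
      mfderiv (𝓡 n) (𝓡 n) F (f t) f' := by
  have h1 : MDifferentiableAt (𝓡 n) (𝓡 n) F (f t) :=
    ((hF _ ht).contMDiffAt (hW.mem_nhds ht)).mdifferentiableAt (by simp)
  have h2 : HasMFDerivWithinAt 𝓘(ℝ, ℝ) (𝓡 n) f J t
      (ContinuousLinearMap.toSpanSingleton ℝ f') :=
    hf'.hasFDerivWithinAt.hasMFDerivWithinAt
  have h3 := h1.hasMFDerivAt.comp_hasMFDerivWithinAt t h2
  have h4 := h3.mfderivWithin hJ.uniqueMDiffWithinAt
  change mfderivWithin 𝓘(ℝ, ℝ) (𝓡 n) (F ∘ f) J t (1 : ℝ) = _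
  rw [h4]
  change mfderiv (𝓡 n) (𝓡 n) F (f t) ((1 : ℝ) • f') = _
  rw [one_smul]

/-- By the chain rule, a condition on the velocity of a curve in the manifold becomes one on
position and velocity in the model space. The predicate `P` is arbitrary, to cover timelike and
causal vectors and also conditions that record the speed. -/
theorem isCurveAt_comp_iff {P : ∀ x : M, TangentSpace (𝓡 n) x → Prop}
    {F : EuclideanSpace ℝ (Fin n) → M}
    {W : Set (EuclideanSpace ℝ (Fin n))} (hW : IsOpen W) (hF : ContMDiffOn (𝓡 n) (𝓡 n) ∞ F W)
    {f : ℝ → EuclideanSpace ℝ (Fin n)} {f' : EuclideanSpace ℝ (Fin n)} {J : Set ℝ} {t : ℝ}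
    (hf : ContDiffWithinAt ℝ 1 f J t)
    (hf' : HasDerivWithinAt f f' J t) (hJ : UniqueDiffWithinAt ℝ J t) (ht : f t ∈ W) :
    IsCurveAt P (fun s ↦ F (f s)) J t ↔ P (F (f t)) (mfderiv (𝓡 n) (𝓡 n) F (f t) f') := by
  have h1 : ContMDiffAt (𝓡 n) (𝓡 n) 1 F (f t) :=
    ((hF _ ht).contMDiffAt (hW.mem_nhds ht)).of_le (by simp)
  have h2 : ContMDiffWithinAt 𝓘(ℝ, ℝ) (𝓡 n) 1 (fun s ↦ F (f s)) J t :=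
    h1.comp_contMDiffWithinAt t hf.contMDiffWithinAt
  unfold IsCurveAt
  rw [mfderivWithin_comp_curve hW hF hf' hJ ht]
  exact and_iff_right h2

/-- The pairs `(y, v)` for which the image of `v` under the differential of `F` at `y ∈ W` is future
directed and timelike. -/
def cone (g : LorentzStructure n M) (F : EuclideanSpace ℝ (Fin n) → M)
    (W : Set (EuclideanSpace ℝ (Fin n))) :
    Set (EuclideanSpace ℝ (Fin n) × EuclideanSpace ℝ (Fin n)) :=
  {p | p.1 ∈ W ∧ g.pullQuad F p < 0 ∧ g.pullTime F p < 0}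

/-- Openness is what permits every deformation of timelike curves below: a `C¹`-small change of a
curve in a chart keeps it timelike. -/
theorem isOpen_cone (g : LorentzStructure n M) {F : EuclideanSpace ℝ (Fin n) → M}
    {W : Set (EuclideanSpace ℝ (Fin n))} (hW : IsOpen W) (hF : ContMDiffOn (𝓡 n) (𝓡 n) ∞ F W) :
    IsOpen (g.cone F W) := by
  have h1 : ContinuousOn (g.pullQuad F) (W ×ˢ univ) := (g.contDiffOn_pullQuad hW hF).continuousOn
  have h2 := g.continuousOn_pullTime hW hF
  have := (h1.prodMk h2).isOpen_inter_preimage (hW.prod isOpen_univ)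
    (isOpen_Iio.prod isOpen_Iio : IsOpen (Iio (0 : ℝ) ×ˢ Iio (0 : ℝ)))
  convert this using 1
  ext p
  simp [cone]

theorem cone_convex (g : LorentzStructure n M) {F : EuclideanSpace ℝ (Fin n) → M}
    {W : Set (EuclideanSpace ℝ (Fin n))} {y v w : EuclideanSpace ℝ (Fin n)}
    (hv : (y, v) ∈ g.cone F W) (hw : (y, w) ∈ g.cone F W) {s : ℝ} (hs0 : 0 ≤ s) (hs1 : s ≤ 1) :
    (y, (1 - s) • v + s • w) ∈ g.cone F W := by
  obtain ⟨hy, hv1, hv2⟩ := hv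
  obtain ⟨-, hw1, hw2⟩ := hw
  have := (g.isLorentzForm (F y)).convex_timelike (g.timeField_timelike (F y))
    hv1 hv2 hw1 hw2 hs0 hs1
  have hlin : ∀ L : EuclideanSpace ℝ (Fin n) →L[ℝ] TangentSpace (𝓡 n) (F y),
      L ((1 - s) • v + s • w) = (1 - s) • L v + s • L w := fun L ↦ by simp
  refine ⟨hy, ?_, ?_⟩
  · exact lt_of_eq_of_lt (congrArg (fun u ↦ g.form (F y) u u) (hlin _)) this.1
  · exact lt_of_eq_of_lt (congrArg (fun u ↦ g.form (F y) (g.timeField (F y)) u) (hlin _)) this.2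

theorem isCurveAt_comp_iff_mem_cone {g : LorentzStructure n M} {F : EuclideanSpace ℝ (Fin n) → M}
    {W : Set (EuclideanSpace ℝ (Fin n))} (hW : IsOpen W) (hF : ContMDiffOn (𝓡 n) (𝓡 n) ∞ F W)
    {f : ℝ → EuclideanSpace ℝ (Fin n)} {f' : EuclideanSpace ℝ (Fin n)} {J : Set ℝ} {t : ℝ}
    (hf : ContDiffWithinAt ℝ 1 f J t)
    (hf' : HasDerivWithinAt f f' J t) (hJ : UniqueDiffWithinAt ℝ J t) (ht : f t ∈ W) :
    IsCurveAt g.FutureTimelike (fun s ↦ F (f s)) J t ↔ (f t, f') ∈ g.cone F W := by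
  rw [isCurveAt_comp_iff hW hF hf hf' hJ ht]
  exact ⟨fun h ↦ ⟨ht, h.1, h.2⟩, fun h ↦ ⟨h.2.1, h.2.2⟩⟩

/-- A `C¹` curve read in a chart. -/
theorem exists_chart_curve {γ : ℝ → M} {J : Set ℝ} (hJ : UniqueDiffOn ℝ J) (x : M)
    (hγ : ContMDiffOn 𝓘(ℝ, ℝ) (𝓡 n) 1 γ J) {t : ℝ} (ht : t ∈ J)
    (hx : γ t ∈ (extChartAt (𝓡 n) x).source) :
    ∃ O : Set ℝ, IsOpen O ∧ t ∈ O ∧ (∀ s ∈ J ∩ O, γ s ∈ (extChartAt (𝓡 n) x).source) ∧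
      ContDiffOn ℝ 1 (fun s ↦ extChartAt (𝓡 n) x (γ s)) (J ∩ O) ∧
      ContinuousOn (derivWithin (fun s ↦ extChartAt (𝓡 n) x (γ s)) J) (J ∩ O) ∧
      ∀ s ∈ J ∩ O, HasDerivWithinAt (fun s ↦ extChartAt (𝓡 n) x (γ s))
        (derivWithin (fun s ↦ extChartAt (𝓡 n) x (γ s)) J s) J s := by
  have h1 := hγ.continuousOn t ht ((isOpen_extChartAt_source x).mem_nhds hx)
  rw [mem_map, mem_nhdsWithin] at h1
  obtain ⟨O, hO, htO, hOs⟩ := h1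
  have hsrc : ∀ s ∈ J ∩ O, γ s ∈ (extChartAt (𝓡 n) x).source := fun s hs ↦ hOs ⟨hs.2, hs.1⟩
  have hcd : ContDiffOn ℝ 1 (fun s ↦ extChartAt (𝓡 n) x (γ s)) (J ∩ O) := by
    rw [← contMDiffOn_iff_contDiffOn]
    have := (contMDiffOn_extChartAt (I := 𝓡 n) (x := x) (n := 1)).comp
      (hγ.mono inter_subset_left) (t := (chartAt (EuclideanSpace ℝ (Fin n)) x).source)
      (fun s hs ↦ by simpa using hsrc s hs)
    exact this
  have hd : ∀ s ∈ O, derivWithin (fun s ↦ extChartAt (𝓡 n) x (γ s)) (J ∩ O) s =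
      derivWithin (fun s ↦ extChartAt (𝓡 n) x (γ s)) J s := fun s hs ↦
    derivWithin_inter (hO.mem_nhds hs)
  refine ⟨O, hO, htO, hsrc, hcd, ?_, fun s hs ↦ ?_⟩
  · exact (hcd.continuousOn_derivWithin (hJ.inter hO) le_rfl).congr fun s hs ↦ (hd s hs.2).symm
  · have := ((hcd.differentiableOn one_ne_zero) s hs).hasDerivWithinAt
    rw [hd s hs.2] at this
    exact (hasDerivWithinAt_inter (hO.mem_nhds hs.2)).1 this

end LorentzStructure

/-! ### `C¹` cut-off functions -/

theorem hasDerivAt_max_zero_sq (x : ℝ) : HasDerivAt (fun y : ℝ ↦ max 0 y ^ 2) (2 * max 0 x) x := by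
  rcases lt_trichotomy x 0 with h | rfl | h
  · rw [max_eq_left h.le, mul_zero]
    refine (hasDerivAt_const x (0 : ℝ)).congr_of_eventuallyEq ?_
    filter_upwards [Iio_mem_nhds h] with y (hy : y < 0)
    simp [max_eq_left hy.le]
  · rw [hasDerivAt_iff_isLittleO]
    simp only [max_self, sub_zero, mul_zero, smul_zero, ne_eq, OfNat.ofNat_ne_zero,
      not_false_eq_true, zero_pow]
    refine Asymptotics.IsBigO.trans_isLittleO (g := fun y : ℝ ↦ y ^ 2) ?_ ?_
    · refine Asymptotics.IsBigO.of_bound 1 (Eventually.of_forall fun y ↦ ?_)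
      rcases le_total y 0 with h | h
      · simp [max_eq_left h, sq_nonneg]
      · simp [max_eq_right h]
    · exact Asymptotics.isLittleO_pow_id one_lt_two
  · rw [max_eq_right h.le]
    have : HasDerivAt (fun y : ℝ ↦ y ^ 2) (2 * x) x := by simpa using hasDerivAt_pow 2 x
    refine this.congr_of_eventuallyEq ?_
    filter_upwards [Ioi_mem_nhds h] with y (hy : 0 < y)
    simp [max_eq_right hy.le]

theorem contDiff_max_zero_sq : ContDiff ℝ 1 (fun y : ℝ ↦ max 0 y ^ 2) := by
  rw [contDiff_one_iff_deriv]
  refine ⟨fun x ↦ (hasDerivAt_max_zero_sq x).differentiableAt, ?_⟩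
  rw [show deriv (fun y : ℝ ↦ max 0 y ^ 2) = fun x ↦ 2 * max 0 x from
    funext fun x ↦ (hasDerivAt_max_zero_sq x).deriv]
  fun_prop

/-- A `C¹` smoothing of the function `t ↦ max 0 t`. -/
theorem exists_smooth_max_zero {ε : ℝ} (hε : 0 < ε) :
    ∃ B B' : ℝ → ℝ, ContDiff ℝ 1 B ∧ (∀ t, HasDerivAt B (B' t) t) ∧ (∀ t, 0 ≤ B' t) ∧
      (∀ t, B' t ≤ 1) ∧ (∀ t ≤ -ε, B t = 0) ∧ (∀ t, ε ≤ t → B t = t) ∧ (∀ t, 0 ≤ B t) ∧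
      (∀ t, t ≤ B t) ∧ ∀ t, B t ≤ max ε t := by
  -- The derivative is the piecewise linear ramp from `0` at `-ε` to `1` at `ε`; this is its
  -- primitive vanishing for `t ≤ -ε`.
  refine ⟨fun t ↦ (max 0 (t + ε) ^ 2 - max 0 (t - ε) ^ 2) / (4 * ε),
    fun t ↦ (max 0 (t + ε) - max 0 (t - ε)) / (2 * ε), ?_, fun t ↦ ?_, fun t ↦ ?_, fun t ↦ ?_,
    fun t ht ↦ ?_, fun t ht ↦ ?_, fun t ↦ ?_, fun t ↦ ?_, fun t ↦ ?_⟩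
  · exact ((contDiff_max_zero_sq.comp (contDiff_id.add contDiff_const)).sub
      (contDiff_max_zero_sq.comp (contDiff_id.sub contDiff_const))).div_const _
  · have h1 := (hasDerivAt_max_zero_sq (t + ε)).comp_add_const t ε
    have h2 := (hasDerivAt_max_zero_sq (t - ε)).comp_sub_const t ε
    convert! (h1.sub h2).div_const (4 * ε) using 1
    field_simp
    ring
  · exact div_nonneg (sub_nonneg.2 (max_le_max le_rfl (by linarith))) (by linarith)
  · rw [div_le_one (by linarith)]
    rcases le_total (t - ε) 0 with h | h
    · rw [max_eq_left h, sub_zero]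
      exact max_le (by linarith) (by linarith)
    · rw [max_eq_right h, max_eq_right (by linarith)]
      linarith
  · simp only
    rw [max_eq_left (by linarith), max_eq_left (by linarith)]
    simp
  · simp only
    rw [max_eq_right (by linarith), max_eq_right (by linarith)]
    field_simp
    ring
  · refine div_nonneg (sub_nonneg.2 ?_) (by linarith)
    exact pow_le_pow_left₀ (le_max_left _ _) (max_le_max le_rfl (by linarith)) 2
  · rw [le_div_iff₀ (by linarith)]
    rcases le_total (t - ε) 0 with h | h
    · rw [max_eq_left h]
      rcases le_total (t + ε) 0 with h' | h'
      · rw [max_eq_left h']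
        nlinarith
      · rw [max_eq_right h']
        nlinarith [sq_nonneg (t - ε)]
    · rw [max_eq_right h, max_eq_right (by linarith)]
      nlinarith
  · rw [div_le_iff₀ (by linarith)]
    rcases le_total (t - ε) 0 with h | h
    · rw [max_eq_left h, max_eq_left (by linarith : t ≤ ε)]
      rcases le_total (t + ε) 0 with h' | h'
      · rw [max_eq_left h']
        nlinarith
      · rw [max_eq_right h']
        nlinarith
    · rw [max_eq_right h, max_eq_right (by linarith), max_eq_right (by linarith : ε ≤ t)]
      nlinarith

/-! ### Deforming timelike curves, and closedness of `D̃⁺(S)` -/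

namespace LorentzStructure

variable {n : ℕ} {M : Type*} [TopologicalSpace M]
  [ChartedSpace (EuclideanSpace ℝ (Fin n)) M] [IsManifold (𝓡 n) ∞ M]

theorem contMDiffOn_extChartAt_symm_model (x : M) :
    ContMDiffOn (𝓡 n) (𝓡 n) ∞ (extChartAt (𝓡 n) x).symm (extChartAt (𝓡 n) x).target :=
  contMDiffOn_extChartAt_symm x

theorem isCurveAt_iff_chart {P : ∀ x : M, TangentSpace (𝓡 n) x → Prop} {γ : ℝ → M} {J O : Set ℝ}
    (hJ : UniqueDiffOn ℝ J) {x : M} (hO : IsOpen O)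
    (hsrc : ∀ s ∈ J ∩ O, γ s ∈ (extChartAt (𝓡 n) x).source)
    (hcd : ContDiffOn ℝ 1 (fun s ↦ extChartAt (𝓡 n) x (γ s)) (J ∩ O)) {s : ℝ} (hs : s ∈ J ∩ O)
    {f' : EuclideanSpace ℝ (Fin n)}
    (hf' : HasDerivWithinAt (fun s ↦ extChartAt (𝓡 n) x (γ s)) f' J s) :
    IsCurveAt P γ J s ↔ P ((extChartAt (𝓡 n) x).symm (extChartAt (𝓡 n) x (γ s)))
      (mfderiv (𝓡 n) (𝓡 n) (extChartAt (𝓡 n) x).symm (extChartAt (𝓡 n) x (γ s)) f') := by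
  have hcs : ContDiffWithinAt ℝ 1 (fun s ↦ extChartAt (𝓡 n) x (γ s)) J s :=
    (contDiffWithinAt_inter (hO.mem_nhds hs.2)).1 (hcd s hs)
  rw [← isCurveAt_comp_iff (P := P) (isOpen_extChartAt_target x) (contMDiffOn_extChartAt_symm_model x)
    hcs hf' (hJ s hs.1) ((extChartAt (𝓡 n) x).map_source (hsrc s hs))]
  have he : γ =ᶠ[𝓝[J] s] fun s ↦ (extChartAt (𝓡 n) x).symm (extChartAt (𝓡 n) x (γ s)) := by
    filter_upwards [self_mem_nhdsWithin, mem_nhdsWithin_of_mem_nhds (hO.mem_nhds hs.2)] with r h1 h2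
    exact ((extChartAt (𝓡 n) x).left_inv (hsrc r ⟨h1, h2⟩)).symm
  exact ⟨fun h ↦ h.congr he.symm hs.1 EventuallyEq.rfl, fun h ↦ h.congr he hs.1 EventuallyEq.rfl⟩

/-- A `C¹` curve germ read in a chart around its base point, with explicit neighbourhoods. -/
theorem exists_chart_timelike (g : LorentzStructure n M) {γ : ℝ → M} {J : Set ℝ}
    (hJ : UniqueDiffOn ℝ J) (hγ : g.IsTimelikeCurveOn γ J) {t : ℝ} (ht : t ∈ J) :
    ∃ f' : ℝ → EuclideanSpace ℝ (Fin n),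
      (extChartAt (𝓡 n) (γ t) (γ t), f' t) ∈
        g.cone (extChartAt (𝓡 n) (γ t)).symm (extChartAt (𝓡 n) (γ t)).target ∧
      ∀ ρ > 0, ∃ η > 0,
        ∀ s ∈ J, dist s t < η →
          γ s ∈ (extChartAt (𝓡 n) (γ t)).source ∧
          dist (extChartAt (𝓡 n) (γ t) (γ s)) (extChartAt (𝓡 n) (γ t) (γ t)) < ρ ∧
          dist (f' s) (f' t) < ρ ∧
          HasDerivWithinAt (fun s ↦ extChartAt (𝓡 n) (γ t) (γ s)) (f' s) J s ∧
          ContDiffWithinAt ℝ 1 (fun s ↦ extChartAt (𝓡 n) (γ t) (γ s)) J s := by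
  obtain ⟨O, hO, htO, hsrc, hcd, hcont, hder⟩ :=
    exists_chart_curve hJ (γ t) hγ.1 ht (mem_extChartAt_source (I := 𝓡 n) (γ t))
  refine ⟨derivWithin (fun s ↦ extChartAt (𝓡 n) (γ t) (γ s)) J, ?_, fun ρ hρ ↦ ?_⟩
  · have := (isCurveAt_iff_chart hJ hO hsrc hcd ⟨ht, htO⟩ (hder t ⟨ht, htO⟩)).1
      (isTimelikeCurveOn_iff.1 hγ t ht)
    exact ⟨mem_extChartAt_target (γ t), this.1, this.2⟩
  · have h1 := Metric.continuousWithinAt_iff.1 (hcd.continuousOn t ⟨ht, htO⟩) ρ hρ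
    have h2 := Metric.continuousWithinAt_iff.1 (hcont t ⟨ht, htO⟩) ρ hρ
    obtain ⟨η₁, hη₁, h1⟩ := h1
    obtain ⟨η₂, hη₂, h2⟩ := h2
    obtain ⟨η₃, hη₃, h3⟩ := Metric.isOpen_iff.1 hO t htO
    refine ⟨min η₁ (min η₂ η₃), by positivity, fun s hs hd ↦ ?_⟩
    simp only [lt_min_iff] at hd
    have hsO : s ∈ J ∩ O := ⟨hs, h3 hd.2.2⟩
    exact ⟨hsrc s hsO, h1 hsO hd.1, h2 hsO hd.2.1, hder s hsO,
      (contDiffWithinAt_inter (hO.mem_nhds hsO.2)).1 (hcd s hsO)⟩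

/-- Position and velocity vary independently in the product of two balls, so velocities of different
curves can all be tested at one common point. -/
theorem exists_ball_cone (g : LorentzStructure n M) {x : M} {v : EuclideanSpace ℝ (Fin n)}
    (hv : (extChartAt (𝓡 n) x x, v) ∈
      g.cone (extChartAt (𝓡 n) x).symm (extChartAt (𝓡 n) x).target) {V : Set M} (hV : V ∈ 𝓝 x) :
    ∃ ρ > 0, ∀ y w, dist y (extChartAt (𝓡 n) x x) < ρ → dist w v < ρ →
      (y, w) ∈ g.cone (extChartAt (𝓡 n) x).symm (extChartAt (𝓡 n) x).target ∧
        (extChartAt (𝓡 n) x).symm y ∈ V := by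
  have h1 := (g.isOpen_cone (isOpen_extChartAt_target x)
    (contMDiffOn_extChartAt_symm_model x)).mem_nhds hv
  have h2 : (extChartAt (𝓡 n) x).symm ⁻¹' V ∈ 𝓝 (extChartAt (𝓡 n) x x) := by
    apply (continuousAt_extChartAt_symm (I := 𝓡 n) x).preimage_mem_nhds
    rwa [(extChartAt (𝓡 n) x).left_inv (mem_extChartAt_source x)]
  obtain ⟨ρ₁, hρ₁, h1⟩ := Metric.mem_nhds_iff.1 h1
  obtain ⟨ρ₂, hρ₂, h2⟩ := Metric.mem_nhds_iff.1 h2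
  refine ⟨min ρ₁ ρ₂, lt_min hρ₁ hρ₂, fun y w hy hw ↦ ⟨h1 ?_, h2 ?_⟩⟩
  · rw [Metric.mem_ball, Prod.dist_eq]
    exact max_lt (hy.trans_le (min_le_left _ _)) (hw.trans_le (min_le_left _ _))
  · exact hy.trans_le (min_le_right _ _)

/-- Two timelike curves meeting at a corner can be joined to a timelike curve, by changing them
only near the corner. -/
theorem exists_timelike_concat (g : LorentzStructure n M) {a c d : ℝ} (hac : a < c) (hcd : c < d)
    {μ ν : ℝ → M} (hμ : g.IsTimelikeCurveOn μ (Ioc a c)) (hν : g.IsTimelikeCurveOn ν (Icc c d))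
    (hμν : μ c = ν c) {V : Set M} (hV : V ∈ 𝓝 (μ c)) :
    ∃ σ : ℝ → M, g.IsTimelikeCurveOn σ (Ioc a d) ∧ σ d = ν d ∧ (∃ c' > a, EqOn σ μ (Iic c')) ∧
      ∀ t ∈ Ioc a d, σ t ∈ μ '' Ioc a c ∪ ν '' Icc c d ∪ V := by
  obtain ⟨f₁', hf₁c, hf₁⟩ := g.exists_chart_timelike (uniqueDiffOn_Ioc a c) hμ
    (right_mem_Ioc.2 hac)
  obtain ⟨f₂', hf₂c, hf₂⟩ := g.exists_chart_timelike (uniqueDiffOn_Icc hcd) hν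
    (left_mem_Icc.2 hcd.le)
  rw [← hμν] at hf₂c hf₂
  set e := extChartAt (𝓡 n) (μ c) with he
  obtain ⟨ρ₁, hρ₁, hcone₁⟩ := g.exists_ball_cone hf₁c hV
  obtain ⟨ρ₂, hρ₂, hcone₂⟩ := g.exists_ball_cone hf₂c hV
  set ρ := min ρ₁ ρ₂ with hρdef
  have hρ : 0 < ρ := lt_min hρ₁ hρ₂
  obtain ⟨η₁, hη₁, hf₁⟩ := hf₁ (ρ / 2) (by positivity)
  obtain ⟨η₂, hη₂, hf₂⟩ := hf₂ (ρ / 2) (by positivity)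
  obtain ⟨η, hη, hηη₁, hηη₂, hηa, hηd⟩ : ∃ η > 0, 2 * η < η₁ ∧ η < η₂ ∧ 2 * η < c - a ∧ η < d - c := by
    refine ⟨min (min (η₁ / 3) (η₂ / 2)) (min ((c - a) / 3) ((d - c) / 2)), ?_, ?_, ?_, ?_, ?_⟩
    · have : 0 < c - a := sub_pos.2 hac
      have : 0 < d - c := sub_pos.2 hcd
      positivity
    · have := (min_le_left (min (η₁ / 3) (η₂ / 2)) (min ((c - a) / 3) ((d - c) / 2))).trans
        (min_le_left _ _)
      linarith
    · have := (min_le_left (min (η₁ / 3) (η₂ / 2)) (min ((c - a) / 3) ((d - c) / 2))).trans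
        (min_le_right _ _)
      linarith
    · have := (min_le_right (min (η₁ / 3) (η₂ / 2)) (min ((c - a) / 3) ((d - c) / 2))).trans
        (min_le_left _ _)
      linarith
    · have := (min_le_right (min (η₁ / 3) (η₂ / 2)) (min ((c - a) / 3) ((d - c) / 2))).trans
        (min_le_right _ _)
      linarith
  -- The smoothing acts on `[c - η/2, c + η/2]` only, strictly inside the window `J`; on the rest of
  -- `J` the new curve is exactly `μ` or `ν`.
  obtain ⟨B, B', hB1, hBd, hB'0, hB'1, hBl, hBr, hB0, hBt, hBle⟩ :=
    exists_smooth_max_zero (half_pos hη)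
  -- `A₁` runs along `μ` and stops at `c`; `A₂` waits at `c` and then runs along `ν`. Since `A₁' = 1
  -- - B'` and `A₂' = B'`, adding the two displacements in the chart gives a curve whose velocity is
  -- a convex combination of the two velocities. As `A₁` can go back to `c - 2η`, the choice of `η`
  -- involves `2 * η` on that side.
  set A₁ : ℝ → ℝ := fun t ↦ t - B (t - c) with hA₁
  set A₂ : ℝ → ℝ := fun t ↦ c + B (t - c) with hA₂
  have hA₁d : ∀ t, HasDerivAt A₁ (1 - B' (t - c)) t := fun t ↦
    (hasDerivAt_id t).sub ((hBd (t - c)).comp_sub_const t c)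
  have hA₂d : ∀ t, HasDerivAt A₂ (B' (t - c)) t := fun t ↦
    ((hBd (t - c)).comp_sub_const t c).const_add c
  have hA₁s : ContDiff ℝ 1 A₁ := contDiff_id.sub (hB1.comp (contDiff_id.sub contDiff_const))
  have hA₂s : ContDiff ℝ 1 A₂ := contDiff_const.add (hB1.comp (contDiff_id.sub contDiff_const))
  set J : Set ℝ := Ioo (c - η) (c + η) with hJ
  have hJB : ∀ t ∈ J, B (t - c) < η := fun t ht ↦
    (hBle (t - c)).trans_lt (max_lt (by linarith) (by linarith [ht.2]))
  have hA₁m : ∀ t ∈ J, A₁ t ∈ Ioc a c ∧ dist (A₁ t) c < η₁ := by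
    intro t ht
    have h1 := hJB t ht
    have h2 := hBt (t - c)
    refine ⟨⟨?_, ?_⟩, ?_⟩
    · simp only [hA₁]; linarith [ht.1]
    · simp only [hA₁]; linarith
    · rw [Real.dist_eq, abs_lt]
      simp only [hA₁]; constructor <;> linarith [ht.1]
  have hA₂m : ∀ t ∈ J, A₂ t ∈ Icc c d ∧ dist (A₂ t) c < η₂ := by
    intro t ht
    have h1 := hJB t ht
    have h2 := hB0 (t - c)
    refine ⟨⟨?_, ?_⟩, ?_⟩
    · simp only [hA₂]; linarith [ht.1]
    · simp only [hA₂]; linarith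
    · rw [Real.dist_eq, abs_lt]
      simp only [hA₂]; constructor <;> linarith [ht.1]
  set f : ℝ → EuclideanSpace ℝ (Fin n) := fun t ↦ e (μ (A₁ t)) + (e (ν (A₂ t)) - e (μ c)) with hf
  have hJn : ∀ t ∈ J, J ∈ 𝓝 t := fun t ht ↦ isOpen_Ioo.mem_nhds ht
  have hfd : ∀ t ∈ J, HasDerivAt f ((1 - B' (t - c)) • f₁' (A₁ t) + B' (t - c) • f₂' (A₂ t)) t := by
    intro t ht
    obtain ⟨-, -, -, h1, -⟩ := hf₁ _ (hA₁m t ht).1 (hA₁m t ht).2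
    obtain ⟨-, -, -, h2, -⟩ := hf₂ _ (hA₂m t ht).1 (hA₂m t ht).2
    have h1' := h1.scomp t (hA₁d t).hasDerivWithinAt (s := J) (fun s hs ↦ (hA₁m s hs).1)
    have h2' := h2.scomp t (hA₂d t).hasDerivWithinAt (s := J) (fun s hs ↦ (hA₂m s hs).1)
    exact (h1'.hasDerivAt (hJn t ht)).add ((h2'.hasDerivAt (hJn t ht)).sub_const _)
  have hfs : ∀ t ∈ J, ContDiffAt ℝ 1 f t := by
    intro t ht
    obtain ⟨-, -, -, -, h1⟩ := hf₁ _ (hA₁m t ht).1 (hA₁m t ht).2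
    obtain ⟨-, -, -, -, h2⟩ := hf₂ _ (hA₂m t ht).1 (hA₂m t ht).2
    have h1' := h1.comp t hA₁s.contDiffAt.contDiffWithinAt (s := J) (fun s hs ↦ (hA₁m s hs).1)
    have h2' := h2.comp t hA₂s.contDiffAt.contDiffWithinAt (s := J) (fun s hs ↦ (hA₂m s hs).1)
    exact (h1'.contDiffAt (hJn t ht)).add ((h2'.contDiffAt (hJn t ht)).sub contDiffAt_const)
  have hfρ : ∀ t ∈ J, dist (f t) (e (μ c)) < ρ := by
    intro t ht
    obtain ⟨-, h1, -⟩ := hf₁ _ (hA₁m t ht).1 (hA₁m t ht).2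
    obtain ⟨-, h2, -⟩ := hf₂ _ (hA₂m t ht).1 (hA₂m t ht).2
    rw [dist_eq_norm] at h1 h2 ⊢
    calc ‖f t - e (μ c)‖ = ‖(e (μ (A₁ t)) - e (μ c)) + (e (ν (A₂ t)) - e (μ c))‖ := by
          simp only [hf]; congr 1; abel
      _ ≤ _ := norm_add_le _ _
      _ < ρ := by linarith
  have hfc : ∀ t ∈ J, (f t, (1 - B' (t - c)) • f₁' (A₁ t) + B' (t - c) • f₂' (A₂ t)) ∈
      g.cone e.symm e.target := by
    intro t ht
    obtain ⟨-, -, h1, -⟩ := hf₁ _ (hA₁m t ht).1 (hA₁m t ht).2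
    obtain ⟨-, -, h2, -⟩ := hf₂ _ (hA₂m t ht).1 (hA₂m t ht).2
    -- Both velocities are compared at the common point `f t`, where the future timelike vectors
    -- form a convex cone.
    exact g.cone_convex
      (hcone₁ _ _ ((hfρ t ht).trans_le (min_le_left _ _)) (by linarith [min_le_left ρ₁ ρ₂])).1
      (hcone₂ _ _ ((hfρ t ht).trans_le (min_le_right _ _)) (by linarith [min_le_right ρ₁ ρ₂])).1
      (hB'0 _) (hB'1 _)
  set σ : ℝ → M := fun t ↦ if t ≤ c - η / 2 then μ t else if t < c + η / 2 then e.symm (f t)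
    else ν t with hσ
  have hσJ : EqOn σ (fun t ↦ e.symm (f t)) J := by
    intro t ht
    simp only [hσ]
    split_ifs with h1 h2
    · have hB : B (t - c) = 0 := hBl _ (by linarith)
      have hA : A₁ t = t := by simp [hA₁, hB]
      have hA' : A₂ t = c := by simp [hA₂, hB]
      obtain ⟨h3, -⟩ := hf₁ _ (hA₁m t ht).1 (hA₁m t ht).2
      simp only [hf, hA', ← hμν, sub_self, add_zero]
      rw [hA] at h3 ⊢
      exact (e.left_inv h3).symm
    · rfl
    · have hB : B (t - c) = t - c := hBr _ (by linarith)
      have hA : A₁ t = c := by simp [hA₁, hB]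
      have hA' : A₂ t = t := by simp [hA₂, hB]
      obtain ⟨h3, -⟩ := hf₂ _ (hA₂m t ht).1 (hA₂m t ht).2
      simp only [hf, hA, add_sub_cancel]
      rw [hA'] at h3 ⊢
      exact (e.left_inv h3).symm
  refine ⟨σ, isTimelikeCurveOn_iff.2 fun t ht ↦ ?_, ?_, ⟨c - η / 2, by linarith, fun t ht ↦ ?_⟩,
    fun t ht ↦ ?_⟩
  · rcases lt_or_ge t (c - η / 2) with h1 | h1
    · refine (isTimelikeCurveOn_iff.1 hμ t ⟨ht.1, by linarith⟩).congr ?_ ht ?_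
      · filter_upwards [mem_nhdsWithin_of_mem_nhds (Iio_mem_nhds h1)] with s hs
        exact if_pos (le_of_lt hs)
      · filter_upwards [Iio_mem_nhds h1] with s hs
        simp only [mem_Iio] at hs
        refine propext (and_congr_right fun _ ↦ ⟨fun _ ↦ ?_, fun _ ↦ ?_⟩) <;> linarith
    · rcases lt_or_ge t (c + η) with h2 | h2
      · have htJ : t ∈ J := ⟨by linarith, h2⟩
        have h3 := (isCurveAt_comp_iff_mem_cone (g := g) (isOpen_extChartAt_target (μ c))
          (contMDiffOn_extChartAt_symm_model (μ c)) (hfs t htJ).contDiffWithinAt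
          (hfd t htJ).hasDerivWithinAt uniqueDiffWithinAt_univ (hfc t htJ).1).2 (hfc t htJ)
        refine h3.congr ?_ ht ?_
        · exact (hσJ.eventuallyEq_of_mem (hJn t htJ)).filter_mono nhdsWithin_le_nhds
        · filter_upwards [hJn t htJ] with s hs
          refine propext ⟨fun _ ↦ trivial, fun _ ↦ ⟨?_, ?_⟩⟩
          · linarith [hs.1]
          · linarith [hs.2]
      · refine (isTimelikeCurveOn_iff.1 hν t ⟨by linarith, ht.2⟩).congr ?_ ht ?_
        · filter_upwards [mem_nhdsWithin_of_mem_nhds (Ioi_mem_nhds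
            (by linarith : c + η / 2 < t))] with s hs
          simp only [mem_Ioi] at hs
          simp only [hσ]
          rw [if_neg (by linarith), if_neg (by linarith)]
        · filter_upwards [Ioi_mem_nhds (by linarith : c < t)] with s hs
          simp only [mem_Ioi] at hs
          exact propext ⟨fun h ↦ ⟨hs.le, h.2⟩, fun h ↦ ⟨by linarith, h.2⟩⟩
  · simp only [hσ]
    rw [if_neg (by linarith), if_neg (by linarith)]
  · exact if_pos ht
  · rcases lt_or_ge t (c - η / 2) with h1 | h1
    · refine Or.inl (Or.inl ⟨t, ⟨ht.1, by linarith⟩, ?_⟩)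
      exact (if_pos h1.le).symm
    · rcases lt_or_ge t (c + η) with h2 | h2
      · have htJ : t ∈ J := ⟨by linarith, h2⟩
        right
        rw [hσJ htJ]
        -- Only the position matters here; the velocity `f₁' c` is an arbitrary admissible choice.
        exact (hcone₁ _ (f₁' c) ((hfρ t htJ).trans_le (min_le_left _ _)) (by simpa using hρ₁)).2
      · refine Or.inl (Or.inr ⟨t, ⟨by linarith, ht.2⟩, ?_⟩)
        simp only [hσ]
        rw [if_neg (by linarith), if_neg (by linarith)]

-- An affine reparametrization multiplies the velocity by `k`. It is needed for shifts (`k = 1`) and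
-- for time reversal (`k = -1`).
omit [IsManifold (𝓡 n) ∞ M] in
theorem IsCurveAt.comp_affine {P : ∀ x : M, TangentSpace (𝓡 n) x → Prop} {γ : ℝ → M}
    {J J' : Set ℝ} {k m t : ℝ} (h : IsCurveAt (fun x v ↦ P x (k • v)) γ J (k * t + m))
    (hu : UniqueDiffWithinAt ℝ J' t) (hJ : MapsTo (fun s ↦ k * s + m) J' J) :
    IsCurveAt P (fun s ↦ γ (k * s + m)) J' t := by
  have h0 : HasDerivAt (fun s : ℝ ↦ k * s + m) k t := by
    simpa using ((hasDerivAt_id t).const_mul k).add_const m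
  have h0s : ContDiff ℝ 1 (fun s : ℝ ↦ k * s + m) := by fun_prop
  obtain ⟨h1, h2⟩ := h
  refine ⟨h1.comp t h0s.contDiffAt.contDiffWithinAt.contMDiffWithinAt hJ, ?_⟩
  have h3 : HasMFDerivWithinAt 𝓘(ℝ, ℝ) 𝓘(ℝ, ℝ) (fun s : ℝ ↦ k * s + m) J' t
      (ContinuousLinearMap.toSpanSingleton ℝ k) :=
    h0.hasDerivWithinAt.hasFDerivWithinAt.hasMFDerivWithinAt
  have h4 := ((h1.mdifferentiableWithinAt one_ne_zero).hasMFDerivWithinAt.comp t h3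
    hJ).mfderivWithin hu.uniqueMDiffWithinAt
  change P _ (mfderivWithin 𝓘(ℝ, ℝ) (𝓡 n) (γ ∘ fun s ↦ k * s + m) J' t (1 : ℝ))
  rw [h4]
  have h5 : ∀ L : ℝ →L[ℝ] EuclideanSpace ℝ (Fin n),
      (L.comp (ContinuousLinearMap.toSpanSingleton ℝ k)) 1 = k • L 1 := by
    intro L
    rw [ContinuousLinearMap.comp_apply, ContinuousLinearMap.toSpanSingleton_apply, one_smul]
    conv_lhs => rw [← mul_one k, ← smul_eq_mul, map_smul]
  exact Eq.mpr (congrArg (P (γ (k * t + m))) (h5 _)) h2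

omit [ChartedSpace (EuclideanSpace ℝ (Fin n)) M] [IsManifold (𝓡 n) ∞ M] in
theorem PastInextendible.congr {γ σ : ℝ → M} {a c : ℝ} (h : PastInextendible γ a) (hac : a < c)
    (hσ : EqOn σ γ (Iic c)) : PastInextendible σ a := by
  rintro ⟨x, hx⟩
  refine h ⟨x, hx.congr' ?_⟩
  filter_upwards [mem_nhdsWithin_of_mem_nhds (Iic_mem_nhds hac)] with t ht
  exact hσ ht

/-- The past of a point of `D̃⁺(S)` along a timelike curve that avoids `S` is in `D̃⁺(S)`. -/
theorem mem_futureTimelikeDomain_of_curve (g : LorentzStructure n M) {S : Set M}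
    (hS : IsClosed S) {c d : ℝ} (hcd : c < d) {ν : ℝ → M} (hν : g.IsTimelikeCurveOn ν (Icc c d))
    (hνS : ∀ t ∈ Icc c d, ν t ∉ S) (hd : ν d ∈ g.futureTimelikeDomain S) :
    ν c ∈ g.futureTimelikeDomain S := by
  intro a b μ hab hμ hμa hμb
  by_contra! hμS
  -- shift the second curve so that it starts at the parameter `b`
  set ν' : ℝ → M := fun t ↦ ν (t + (c - b)) with hν'
  have hν't : g.IsTimelikeCurveOn ν' (Icc b (b + (d - c))) := by
    rw [isTimelikeCurveOn_iff] at hν ⊢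
    intro t ht
    have ht' : 1 * t + (c - b) ∈ Icc c d := ⟨by linarith [ht.1], by linarith [ht.2]⟩
    have := IsCurveAt.comp_affine (P := g.FutureTimelike) (γ := ν) (J := Icc c d) (k := 1) (m := c - b)
      (J' := Icc b (b + (d - c)))
      (by simpa only [one_smul] using hν _ ht') (uniqueDiffOn_Icc (by linarith) t ht)
      (fun s hs ↦ ⟨by linarith [hs.1], by linarith [hs.2]⟩)
    simpa only [one_mul] using this
  -- Prolonging `μ` by `ν` gives a past inextendible curve ending at `ν d`. The corner is rounded
  -- inside the open set `Sᶜ`, so the result still avoids `S`.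
  obtain ⟨σ, hσ, hσd, ⟨c', hc', hσμ⟩, hσS⟩ := g.exists_timelike_concat hab
    (by linarith : b < b + (d - c)) hμ hν't (by simp [hν', hμb])
    (hS.isOpen_compl.mem_nhds (hμS b (right_mem_Ioc.2 hab)))
  obtain ⟨t, ht, htS⟩ := hd a (b + (d - c)) σ (by linarith) hσ (hμa.congr hc' hσμ)
    (by rw [hσd, hν']; ring_nf)
  rcases hσS t ht with (⟨s, hs, hst⟩ | ⟨s, hs, hst⟩) | h
  · exact hμS s hs (hst ▸ htS)
  · refine hνS (s + (c - b)) ⟨by linarith [hs.1], by linarith [hs.2]⟩ ?_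
    rw [← hst] at htS
    exact htS
  · exact h htS

/-- A curve showing that a point is not in the set can be bent near its end so as to end at any
nearby point. It stays timelike because the cone is open, and off `S` because `Sᶜ` is open. -/
theorem isClosed_futureTimelikeDomain (g : LorentzStructure n M) {S : Set M} (hS : IsClosed S) :
    IsClosed (g.futureTimelikeDomain S) := by
  rw [← isOpen_compl_iff, isOpen_iff_mem_nhds]
  intro p hp
  simp only [mem_compl_iff, futureTimelikeDomain, mem_ofPred_eq, not_forall] at hp
  obtain ⟨a, b, γ, hab, hγ, hγa, rfl, hγS⟩ := hp
  push Not at hγS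
  obtain ⟨f₁', hf₁c, hf₁⟩ := g.exists_chart_timelike (uniqueDiffOn_Ioc a b) hγ
    (right_mem_Ioc.2 hab)
  obtain ⟨ρ, hρ, hcone⟩ := g.exists_ball_cone hf₁c
    (hS.isOpen_compl.mem_nhds (hγS b (right_mem_Ioc.2 hab)))
  set e := extChartAt (𝓡 n) (γ b) with he
  obtain ⟨η, hη, hf₁⟩ := hf₁ (ρ / 2) (by positivity)
  obtain ⟨ε, hε, hεη, hεa⟩ : ∃ ε > 0, ε < η ∧ ε < b - a := by
    have : 0 < b - a := sub_pos.2 hab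
    refine ⟨min η (b - a) / 2, by positivity, ?_, ?_⟩
    · linarith [min_le_left η (b - a), lt_min hη this]
    · linarith [min_le_right η (b - a), lt_min hη this]
  -- The first bound controls the displacement `w` of the end point; the second controls the change
  -- of velocity, which is at most `(2 / ε) * ‖w‖`.
  set δ := min (ρ / 2) (ε * ρ / 4) with hδ
  have hδ0 : 0 < δ := by positivity
  have h1 : e ⁻¹' Metric.ball (e (γ b)) δ ∈ 𝓝 (γ b) :=
    (continuousAt_extChartAt (γ b)).preimage_mem_nhds (Metric.ball_mem_nhds _ hδ0)
  filter_upwards [h1, extChartAt_source_mem_nhds (I := 𝓡 n) (γ b)] with q hq hqs hqD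
  set w := e q - e (γ b) with hw
  have hwδ : ‖w‖ < δ := by rw [← dist_eq_norm]; exact hq
  set c := b - ε with hc
  -- The coefficient of `w` is `0` up to `c`, `C¹` across `c`, and `1` at `b`, so `f` leaves the old
  -- curve smoothly and ends at `e q`.
  set f : ℝ → EuclideanSpace ℝ (Fin n) := fun t ↦ e (γ t) + (max 0 (t - c) ^ 2 / ε ^ 2) • w with hf
  set J : Set ℝ := Ioc a b ∩ Metric.ball b η with hJ
  have hJd : ∀ t ∈ J, dist t b < η := fun t ht ↦ ht.2
  have hmx : ∀ t ∈ J, max 0 (t - c) ≤ ε := fun t ht ↦ max_le hε.le (by linarith [ht.1.2])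
  have hfd : ∀ t ∈ J, HasDerivWithinAt f
      (f₁' t + (2 * max 0 (t - c) / ε ^ 2) • w) (Ioc a b) t := by
    intro t ht
    obtain ⟨-, -, -, h1, -⟩ := hf₁ t ht.1 (hJd t ht)
    have h2 := (((hasDerivAt_max_zero_sq (t - c)).comp_sub_const t c).div_const (ε ^ 2)).smul_const w
    exact h1.add h2.hasDerivWithinAt
  have hfs : ∀ t ∈ J, ContDiffWithinAt ℝ 1 f (Ioc a b) t := by
    intro t ht
    obtain ⟨-, -, -, -, h1⟩ := hf₁ t ht.1 (hJd t ht)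
    have h2 : ContDiff ℝ 1 (fun t ↦ (max 0 (t - c) ^ 2 / ε ^ 2) • w) :=
      ((contDiff_max_zero_sq.comp (contDiff_id.sub contDiff_const)).div_const _).smul contDiff_const
    exact h1.add h2.contDiffAt.contDiffWithinAt
  have hfc : ∀ t ∈ J, (f t, f₁' t + (2 * max 0 (t - c) / ε ^ 2) • w) ∈ g.cone e.symm e.target ∧
      e.symm (f t) ∈ Sᶜ := by
    intro t ht
    obtain ⟨-, h1, h2, -⟩ := hf₁ t ht.1 (hJd t ht)
    have h0 : 0 ≤ max 0 (t - c) := le_max_left _ _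
    have h3 := hmx t ht
    rw [dist_eq_norm] at h1 h2
    apply hcone
    · rw [dist_eq_norm]
      calc ‖f t - e (γ b)‖ = ‖(e (γ t) - e (γ b)) + (max 0 (t - c) ^ 2 / ε ^ 2) • w‖ := by
            simp only [hf]; congr 1; abel
        _ ≤ ‖e (γ t) - e (γ b)‖ + ‖(max 0 (t - c) ^ 2 / ε ^ 2) • w‖ := norm_add_le _ _
        _ ≤ ‖e (γ t) - e (γ b)‖ + 1 * ‖w‖ := by
            rw [norm_smul, Real.norm_of_nonneg (by positivity)]
            gcongr
            rw [div_le_one (by positivity)]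
            gcongr
        _ < ρ := by linarith [min_le_left (ρ / 2) (ε * ρ / 4)]
    · rw [dist_eq_norm]
      calc ‖f₁' t + (2 * max 0 (t - c) / ε ^ 2) • w - f₁' b‖
          = ‖(f₁' t - f₁' b) + (2 * max 0 (t - c) / ε ^ 2) • w‖ := by congr 1; abel
        _ ≤ ‖f₁' t - f₁' b‖ + ‖(2 * max 0 (t - c) / ε ^ 2) • w‖ := norm_add_le _ _
        _ ≤ ‖f₁' t - f₁' b‖ + 2 / ε * ‖w‖ := by
            rw [norm_smul, Real.norm_of_nonneg (by positivity)]
            have h4 : 2 * max 0 (t - c) / ε ^ 2 ≤ 2 / ε := by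
              rw [div_le_div_iff₀ (by positivity) hε]
              nlinarith [mul_le_mul_of_nonneg_right h3 hε.le]
            gcongr
        _ < ρ := by
            have h4 : ‖w‖ < ε * ρ / 4 := hwδ.trans_le (min_le_right _ _)
            have h5 : 2 / ε * ‖w‖ < 2 / ε * (ε * ρ / 4) := by gcongr
            have h6 : 2 / ε * (ε * ρ / 4) = ρ / 2 := by field_simp; norm_num
            linarith
  set σ : ℝ → M := fun t ↦ if t ≤ c then γ t else e.symm (f t) with hσ
  have hσJ : EqOn σ (fun t ↦ e.symm (f t)) J := by
    intro t ht
    simp only [hσ]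
    split_ifs with h1
    · obtain ⟨h3, -⟩ := hf₁ t ht.1 (hJd t ht)
      simp only [hf, max_eq_left (sub_nonpos.2 h1)]
      simpa using (e.left_inv h3).symm
    · rfl
  have hmem : ∀ t ∈ Ioc a b, c ≤ t → t ∈ J := fun t ht h ↦
    ⟨ht, by rw [Metric.mem_ball, Real.dist_eq, abs_lt]; constructor <;> linarith [ht.2]⟩
  have hσt : g.IsTimelikeCurveOn σ (Ioc a b) := by
    refine isTimelikeCurveOn_iff.2 fun t ht ↦ ?_
    rcases lt_or_ge t c with h1 | h1
    · refine (isTimelikeCurveOn_iff.1 hγ t ht).congr ?_ ht EventuallyEq.rfl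
      filter_upwards [mem_nhdsWithin_of_mem_nhds (Iio_mem_nhds h1)] with s hs
      exact if_pos (le_of_lt hs)
    · have htJ := hmem t ht h1
      refine ((isCurveAt_comp_iff_mem_cone (g := g) (isOpen_extChartAt_target (γ b))
        (contMDiffOn_extChartAt_symm_model (γ b)) (hfs t htJ) (hfd t htJ)
        (uniqueDiffOn_Ioc a b t ht) (hfc t htJ).1.1).2 (hfc t htJ).1).congr ?_ ht EventuallyEq.rfl
      exact hσJ.eventuallyEq_of_mem
        (inter_mem_nhdsWithin _ (Metric.isOpen_ball.mem_nhds htJ.2))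
  have hσb : σ b = q := by
    rw [hσJ (hmem b (right_mem_Ioc.2 hab) (by linarith))]
    have h1 : max 0 (b - c) = ε := by rw [max_eq_right] <;> linarith
    simp only [hf, h1, div_self (pow_ne_zero 2 hε.ne'), one_smul, hw, add_sub_cancel]
    exact e.left_inv hqs
  obtain ⟨t, ht, htS⟩ := hqD a b σ hab hσt
    (hγa.congr (by linarith : a < c) fun t ht ↦ if_pos ht) hσb
  rcases le_or_gt t c with h1 | h1
  · simp only [hσ, if_pos h1] at htS
    exact hγS t ht htS
  · have htJ := hmem t ht h1.le
    rw [hσJ htJ] at htS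
    exact (hfc t htJ).2 htS

end LorentzStructure

/-! ### Keeping a causal curve of the pulled-back metric inside `D̃⁺(S)` -/

/-- If `Q` is strictly differentiable at `(x₀, v₀)` and decreases in the direction `(0, T)`, then
pushing a point with `Q ≤ 0` near `(x₀, v₀)` along `T` makes `Q` negative. -/
theorem HasStrictFDerivAt.exists_push_neg {E : Type*} [NormedAddCommGroup E] [NormedSpace ℝ E]
    {Q : E × E → ℝ} {D : E × E →L[ℝ] ℝ} {x₀ v₀ T : E} (hQ : HasStrictFDerivAt Q D (x₀, v₀))
    (hD : D (0, T) < 0) {U : Set (E × E)} (hU : U ∈ 𝓝 (x₀, v₀)) :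
    ∃ ρ > 0, ∃ ε > 0, ∃ s₀ > 0, ∀ y w, dist y x₀ < ρ → dist w v₀ < ρ → Q (y, w) ≤ 0 →
      (y, w) ∈ U ∧ ∀ s : ℝ, 0 < s → s < s₀ → ∀ r : ℝ, 0 ≤ r → r ≤ ε →
        (y - (s * r) • T, w + s • T) ∈ U ∧ Q (y - (s * r) • T, w + s • T) < 0 := by
  set κ := -D (0, T) with hκ
  have hκ0 : 0 < κ := by rw [hκ]; linarith
  have hc : 0 < κ / (4 * (‖T‖ + 1)) := by positivity
  have h1 := (hasStrictFDerivAt_iff_isLittleO.1 hQ).def hc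
  obtain ⟨U', hU', h1⟩ := mem_prod_same_iff.1 (nhds_prod_eq (x := (x₀, v₀)) (y := (x₀, v₀)) ▸ h1)
  obtain ⟨R, hR, hball⟩ := Metric.mem_nhds_iff.1 (inter_mem hU hU')
  -- The linear change of `Q` under the push is `s * (-κ - r * D (T, 0))`. The bound on `r` makes
  -- the second term at most `s * κ / 2` and `hc` makes the error at most `s * κ / 4`, which leaves
  -- `-s * κ / 4`. The bounds on `r` do not depend on `s`, so `s` can later tend to `0`.
  refine ⟨R / 2, by positivity, min 1 (κ / (2 * (|D (T, 0)| + 1))), by positivity,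
    R / (2 * (‖T‖ + 1)), by positivity, fun y w hy hw hyw ↦ ?_⟩
  have hq : (y, w) ∈ Metric.ball (x₀, v₀) R := by
    rw [Metric.mem_ball, Prod.dist_eq]
    exact max_lt (by dsimp only; linarith) (by dsimp only; linarith)
  refine ⟨(hball hq).1, fun s hs hs₀ r hr hrε ↦ ?_⟩
  have hr1 : r ≤ 1 := hrε.trans (min_le_left _ _)
  have hsT : s * ‖T‖ < R / 2 := by
    have : s * (‖T‖ + 1) < R / (2 * (‖T‖ + 1)) * (‖T‖ + 1) := by gcongr
    have h2 : R / (2 * (‖T‖ + 1)) * (‖T‖ + 1) = R / 2 := by field_simp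
    nlinarith [norm_nonneg T]
  have hsr : s * r ≤ s := by nlinarith
  have hsrT : ‖(s * r) • T‖ ≤ s * ‖T‖ := by
    rw [norm_smul, Real.norm_of_nonneg (by positivity)]
    gcongr
  have hsT' : ‖s • T‖ = s * ‖T‖ := by
    rw [norm_smul, Real.norm_of_nonneg hs.le]
  have hp : (y - (s * r) • T, w + s • T) ∈ Metric.ball (x₀, v₀) R := by
    rw [Metric.mem_ball, Prod.dist_eq]
    rw [dist_eq_norm] at hy hw
    apply max_lt
    · rw [dist_eq_norm, show y - (s * r) • T - x₀ = (y - x₀) - (s * r) • T by abel]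
      exact (norm_sub_le _ _).trans_lt (by linarith)
    · rw [dist_eq_norm, show w + s • T - v₀ = (w - v₀) + s • T by abel]
      exact (norm_add_le _ _).trans_lt (by linarith)
  refine ⟨(hball hp).1, ?_⟩
  -- Two moving points are compared, neither being the centre `(x₀, v₀)`: this is where strict
  -- differentiability is needed.
  have h2 := h1 (mk_mem_prod (hball hp).2 (hball hq).2)
  rw [mem_ofPred_eq] at h2
  have h3 : (y - (s * r) • T, w + s • T) - (y, w) = s • ((0, T) - r • (T, 0) : E × E) := by
    ext <;> simp [mul_smul]
  have h4 : ‖(y - (s * r) • T, w + s • T) - (y, w)‖ ≤ s * ‖T‖ := by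
    rw [Prod.mk_sub_mk, Prod.norm_def]
    apply max_le
    · simpa using hsrT
    · simpa using hsT'.le
  have h5 : D ((y - (s * r) • T, w + s • T) - (y, w)) = s * (-κ - r * D (T, 0)) := by
    rw [h3, map_smul, map_sub, map_smul, smul_eq_mul, smul_eq_mul, hκ, neg_neg]
  simp only at h2
  rw [h5, Real.norm_eq_abs] at h2
  have h6 := (le_abs_self _).trans h2
  have h7 : κ / (4 * (‖T‖ + 1)) * ‖(y - (s * r) • T, w + s • T) - (y, w)‖ ≤ s * (κ / 4) := by
    calc _ ≤ κ / (4 * (‖T‖ + 1)) * (s * (‖T‖ + 1)) := by gcongr; nlinarith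
      _ = s * (κ / 4) := by field_simp
  have h8 : -(r * D (T, 0)) ≤ κ / 2 := by
    have h9 : r * |D (T, 0)| ≤ κ / (2 * (|D (T, 0)| + 1)) * (|D (T, 0)| + 1) := by
      gcongr
      · exact hrε.trans (min_le_right _ _)
      · linarith
    have h10 : κ / (2 * (|D (T, 0)| + 1)) * (|D (T, 0)| + 1) = κ / 2 := by field_simp
    nlinarith [neg_abs_le (D (T, 0))]
  have h11 : s * (-κ - r * D (T, 0)) ≤ s * (-κ + κ / 2) := by
    gcongr
    linarith
  nlinarith [mul_pos hs hκ0]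

namespace LorentzStructure

variable {n : ℕ} {M : Type*} [TopologicalSpace M]
  [ChartedSpace (EuclideanSpace ℝ (Fin n)) M] [IsManifold (𝓡 n) ∞ M]

theorem pullQuad_add_smul (g : LorentzStructure n M) (F : EuclideanSpace ℝ (Fin n) → M)
    (y v w : EuclideanSpace ℝ (Fin n)) (s : ℝ) :
    g.pullQuad F (y, v + s • w) = g.pullQuad F (y, v) +
      s * (2 * g.metric (F y) (mfderiv (𝓡 n) (𝓡 n) F y v) (mfderiv (𝓡 n) (𝓡 n) F y w)) +
      s ^ 2 * g.pullQuad F (y, w) := by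
  have hlin : ∀ L : EuclideanSpace ℝ (Fin n) →L[ℝ] TangentSpace (𝓡 n) (F y),
      g.form (F y) (L (v + s • w)) (L (v + s • w)) = g.form (F y) (L v) (L v) +
        s * (2 * g.form (F y) (L v) (L w)) + s ^ 2 * g.form (F y) (L w) (L w) := by
    intro L
    have := (g.isLorentzForm (F y)).1 (L w) (L v)
    simp only [map_add, map_smul, LinearMap.add_apply, LinearMap.smul_apply, smul_eq_mul, this]
    ring
  exact hlin _

/-- Polarization: metrics whose quadratic forms agree at a point agree as bilinear forms there. -/
theorem pullQuad_polar (g : LorentzStructure n M) (F : EuclideanSpace ℝ (Fin n) → M)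
    (y v w : EuclideanSpace ℝ (Fin n)) :
    2 * g.metric (F y) (mfderiv (𝓡 n) (𝓡 n) F y v) (mfderiv (𝓡 n) (𝓡 n) F y w) =
      g.pullQuad F (y, v + w) - g.pullQuad F (y, v) - g.pullQuad F (y, w) := by
  have := g.pullQuad_add_smul F y v w 1
  simp only [one_smul] at this
  linarith

/-- The form is quadratic in the vector, so its derivative in a vertical direction is twice the
pairing. Pushing along `T` thus lowers it exactly when that pairing is negative. -/
theorem fderiv_pullQuad_snd (g : LorentzStructure n M) {F : EuclideanSpace ℝ (Fin n) → M}
    {y v : EuclideanSpace ℝ (Fin n)} (hd : DifferentiableAt ℝ (g.pullQuad F) (y, v))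
    (T : EuclideanSpace ℝ (Fin n)) :
    fderiv ℝ (g.pullQuad F) (y, v) (0, T) =
      2 * g.metric (F y) (mfderiv (𝓡 n) (𝓡 n) F y v) (mfderiv (𝓡 n) (𝓡 n) F y T) := by
  have h1 : HasDerivAt (fun s : ℝ ↦ (y, v + s • T)) (0, T) 0 := by
    have h0 : HasDerivAt (fun s : ℝ ↦ v + s • T) T 0 := by
      simpa using ((hasDerivAt_id (0 : ℝ)).smul_const T).const_add v
    exact (hasDerivAt_const (0 : ℝ) y).prodMk h0
  have h2 : HasDerivAt (fun s : ℝ ↦ g.pullQuad F (y, v + s • T))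
      (fderiv ℝ (g.pullQuad F) (y, v) (0, T)) 0 := by
    have h3 : HasFDerivAt (g.pullQuad F) (fderiv ℝ (g.pullQuad F) (y, v))
        ((fun s : ℝ ↦ (y, v + s • T)) 0) := by
      simpa using hd.hasFDerivAt
    exact h3.comp_hasDerivAt (0 : ℝ) h1
  set β := 2 * g.metric (F y) (mfderiv (𝓡 n) (𝓡 n) F y v) (mfderiv (𝓡 n) (𝓡 n) F y T) with hβ
  have h4 : HasDerivAt (fun s : ℝ ↦ g.pullQuad F (y, v + s • T)) β 0 := by
    have := (((hasDerivAt_id (0 : ℝ)).mul_const β).const_add (g.pullQuad F (y, v))).add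
      ((hasDerivAt_pow 2 (0 : ℝ)).mul_const (g.pullQuad F (y, T)))
    refine HasDerivAt.congr_deriv (this.congr_of_eventuallyEq
      (Eventually.of_forall fun s ↦ g.pullQuad_add_smul F y v T s)) (by simp)
  exact h2.unique h4

theorem mfderiv_extChartAt_symm_surjective (x : M) {y : EuclideanSpace ℝ (Fin n)}
    (hy : y ∈ (extChartAt (𝓡 n) x).target)
    (v : TangentSpace (𝓡 n) ((extChartAt (𝓡 n) x).symm y)) : ∃ T : EuclideanSpace ℝ (Fin n),
      mfderiv (𝓡 n) (𝓡 n) (extChartAt (𝓡 n) x).symm y T = v := by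
  have h := isInvertible_mfderivWithin_extChartAt_symm hy
  rw [ModelWithCorners.range_eq_univ, mfderivWithin_univ] at h
  exact h.bijective.surjective v

variable {N : Type*} [TopologicalSpace N]
  [ChartedSpace (EuclideanSpace ℝ (Fin n)) N] [IsManifold (𝓡 n) ∞ N]

/-- Let `u` be a curve in the chart at `x` that ends at `x ∈ D̃⁺(S) \ S`. If `u` is causal for the
metric pulled back under a map `F` that is isometric on `D̃⁺(S)`, and its final velocity is future
directed, then `u` stays in `D̃⁺(S)` near its end. -/
theorem eventually_mem_futureTimelikeDomain (g : LorentzStructure n M) (h : LorentzStructure n N)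
    {S : Set M} (hS : IsClosed S) {x : M} (hxD : x ∈ g.futureTimelikeDomain S) (hxS : x ∉ S)
    {W : Set (EuclideanSpace ℝ (Fin n))} (hW : IsOpen W) (hxW : extChartAt (𝓡 n) x x ∈ W)
    {F : EuclideanSpace ℝ (Fin n) → N} (hF : ContMDiffOn (𝓡 n) (𝓡 n) ∞ F W)
    (hiso : ∀ y ∈ W, (extChartAt (𝓡 n) x).symm y ∈ g.futureTimelikeDomain S → ∀ v,
      h.pullQuad F (y, v) = g.pullQuad (extChartAt (𝓡 n) x).symm (y, v))
    {u u' : ℝ → EuclideanSpace ℝ (Fin n)} {a b : ℝ} (hab : a < b)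
    (hu : ContDiffOn ℝ 1 u (Icc a b)) (hu' : ∀ t ∈ Icc a b, HasDerivWithinAt u (u' t) (Icc a b) t)
    (hub : u b = extChartAt (𝓡 n) x x) (huc : ∀ t ∈ Icc a b, h.pullQuad F (u t, u' t) ≤ 0)
    (hor : g.pullTime (extChartAt (𝓡 n) x).symm (u b, u' b) < 0) :
    ∃ c ∈ Ico a b, ∀ t ∈ Icc c b, (extChartAt (𝓡 n) x).symm (u t) ∈ g.futureTimelikeDomain S := by
  have hu'c : ContinuousOn u' (Icc a b) :=
    (hu.continuousOn_derivWithin (uniqueDiffOn_Icc hab) le_rfl).congr fun t ht ↦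
      ((hu' t ht).derivWithin (uniqueDiffOn_Icc hab t ht)).symm
  have hx0 : (extChartAt (𝓡 n) x).symm (extChartAt (𝓡 n) x x) = x := extChartAt_to_inv x
  have hxt : extChartAt (𝓡 n) x x ∈ (extChartAt (𝓡 n) x).target := mem_extChartAt_target x
  set e := extChartAt (𝓡 n) x with he
  rw [hub] at hor
  obtain ⟨T, hT⟩ := mfderiv_extChartAt_symm_surjective x hxt (g.timeField (e.symm (e x)))
  have hQ : ContDiffAt ℝ ∞ (h.pullQuad F) (e x, u' b) :=
    (h.contDiffOn_pullQuad hW hF).contDiffAt ((hW.prod isOpen_univ).mem_nhds ⟨hxW, trivial⟩)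
  have hQs := hQ.hasStrictFDerivAt (by simp)
  -- At the base point `x ∈ D̃⁺(S)` both metrics agree, so the pairing of `u' b` with `T` can be
  -- computed in `g`, where `T` represents the time field.
  have hDT : fderiv ℝ (h.pullQuad F) (e x, u' b) (0, T) < 0 := by
    rw [h.fderiv_pullQuad_snd (hQ.differentiableAt (by simp)), h.pullQuad_polar,
      hiso _ hxW (by rwa [hx0]), hiso _ hxW (by rwa [hx0]), hiso _ hxW (by rwa [hx0]), ← g.pullQuad_polar, hT, g.symm]
    have : g.metric (e.symm (e x)) (g.timeField (e.symm (e x)))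
      (mfderiv (𝓡 n) (𝓡 n) e.symm (e x) (u' b)) < 0 := hor
    linarith
  -- the region in which everything takes place
  set W' := W ∩ (e.target ∩ e.symm ⁻¹' Sᶜ) with hW'
  have hW'o : IsOpen W' := hW.inter ((continuousOn_extChartAt_symm x).isOpen_inter_preimage
    (isOpen_extChartAt_target x) hS.isOpen_compl)
  have hxW' : e x ∈ W' := ⟨hxW, hxt, by rwa [mem_preimage, hx0]⟩
  have hU : (W' ×ˢ univ) ∩ {p | g.pullTime e.symm p < 0} ∈ 𝓝 (e x, u' b) := by
    refine IsOpen.mem_nhds ?_ ⟨⟨hxW', trivial⟩, hor⟩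
    exact ((g.continuousOn_pullTime (isOpen_extChartAt_target x)
      (contMDiffOn_extChartAt_symm_model x)).mono
      (prod_mono (fun y hy ↦ hy.2.1) le_rfl)).isOpen_inter_preimage
      (hW'o.prod isOpen_univ) isOpen_Iio
  obtain ⟨ρ, hρ, ε, hε, s₀, hs₀, hpush⟩ := hQs.exists_push_neg hDT hU
  obtain ⟨η₁, hη₁, hc₁⟩ := Metric.continuousWithinAt_iff.1
    (hu.continuousOn b (right_mem_Icc.2 hab.le)) ρ hρ
  obtain ⟨η₂, hη₂, hc₂⟩ := Metric.continuousWithinAt_iff.1 (hu'c b (right_mem_Icc.2 hab.le)) ρ hρ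
  rw [hub] at hc₁
  obtain ⟨c, hc, hcε, hcη₁, hcη₂⟩ : ∃ c ∈ Ico a b, b - c ≤ ε ∧ b - c < η₁ ∧ b - c < η₂ := by
    have h0 : 0 < min (min ε (b - a)) (min η₁ η₂) :=
      lt_min (lt_min hε (sub_pos.2 hab)) (lt_min hη₁ hη₂)
    have h1 := min_le_left (min ε (b - a)) (min η₁ η₂)
    have h2 := min_le_right (min ε (b - a)) (min η₁ η₂)
    have h3 := h1.trans (min_le_left _ _)
    have h4 := h1.trans (min_le_right _ _)
    have h5 := h2.trans (min_le_left _ _)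
    have h6 := h2.trans (min_le_right _ _)
    refine ⟨b - min (min ε (b - a)) (min η₁ η₂) / 2, ⟨?_, ?_⟩, ?_, ?_, ?_⟩ <;> linarith
  have hcab : Icc c b ⊆ Icc a b := Icc_subset_Icc_left hc.1
  have hpush'' := fun t (ht : t ∈ Icc c b) ↦ by
    have hd : dist t b ≤ b - c := by
      rw [Real.dist_eq, abs_le]
      constructor <;> linarith [ht.1, ht.2]
    exact hpush _ _ (hc₁ (hcab ht) (by linarith)) (hc₂ (hcab ht) (by linarith)) (huc t (hcab ht))
  have hpush' : ∀ s, 0 < s → s < s₀ → ∀ t ∈ Icc c b,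
      (u t - (s * (b - t)) • T, u' t + s • T) ∈ (W' ×ˢ univ) ∩ {p | g.pullTime e.symm p < 0} ∧
        h.pullQuad F (u t - (s * (b - t)) • T, u' t + s • T) < 0 := by
    intro s hs hs' t ht
    exact (hpush'' t ht).2 s hs hs' _ (by linarith [ht.2]) (by linarith [ht.1])
  have hmain : ∀ s, 0 < s → s < s₀ → ∀ t ∈ Icc c b,
      e.symm (u t - (s * (b - t)) • T) ∈ g.futureTimelikeDomain S := by
    intro s hs hs'
    set f : ℝ → EuclideanSpace ℝ (Fin n) := fun t ↦ u t - (s * (b - t)) • T with hf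
    have hfC : ContDiffOn ℝ 1 f (Icc c b) := (hu.mono hcab).sub
      (by fun_prop : ContDiff ℝ 1 fun t : ℝ ↦ (s * (b - t)) • T).contDiffOn
    have hfd : ∀ t ∈ Icc c b, HasDerivWithinAt f (u' t + s • T) (Icc c b) t := by
      intro t ht
      have h1 : HasDerivAt (fun t : ℝ ↦ (s * (b - t)) • T) (-s • T) t := by
        have := (((hasDerivAt_id t).const_sub b).const_mul s).smul_const T
        simpa using this
      have := ((hu' t (hcab ht)).mono hcab).sub h1.hasDerivWithinAt
      rwa [neg_smul, sub_neg_eq_add] at this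
    have hfcont : ContinuousOn (fun t ↦ (f t, u' t + s • T)) (Icc c b) :=
      hfC.continuousOn.prodMk ((hu'c.mono hcab).add continuousOn_const)
    have hft : ∀ t ∈ Icc c b, f t ∈ W' := fun t ht ↦ (hpush' s hs hs' t ht).1.1.1
    have hclosed : IsClosed ((fun t ↦ e.symm (f t)) ⁻¹' g.futureTimelikeDomain S ∩ Icc c b) := by
      rw [inter_comm]
      refine ContinuousOn.preimage_isClosed_of_isClosed ?_ isClosed_Icc
        (g.isClosed_futureTimelikeDomain hS)
      exact (continuousOn_extChartAt_symm x).comp hfC.continuousOn fun t ht ↦ (hft t ht).2.1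
    -- Continuous induction, downwards from `b`, where the perturbed curve passes through `x`.
    refine hclosed.Icc_subset_of_forall_exists_lt ?_ ?_
    · simp only [mem_preimage, hf, sub_self, mul_zero, zero_smul, sub_zero, hub, hx0]
      exact hxD
    · rintro t ⟨htD, ht⟩ y hy
      have htI : t ∈ Icc c b := ⟨ht.1.le, ht.2⟩
      -- The perturbed velocity is timelike for the pulled-back metric everywhere on `[c, b]`, but
      -- for `g` only where the two metrics are known to agree, that is, at points already in
      -- `D̃⁺(S)`.
      have hcone : (f t, u' t + s • T) ∈ g.cone e.symm e.target := by
        refine ⟨(hft t htI).2.1, ?_, (hpush' s hs hs' t htI).1.2⟩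
        rw [← hiso _ (hft t htI).1 htD]
        exact (hpush' s hs hs' t htI).2
      have hnear := (hfcont t htI) ((g.isOpen_cone (isOpen_extChartAt_target x)
        (contMDiffOn_extChartAt_symm_model x)).mem_nhds hcone)
      rw [mem_map, Metric.mem_nhdsWithin_iff] at hnear
      obtain ⟨δ, hδ, hnear⟩ := hnear
      obtain ⟨r, hrc, hry, hrδ, hrt⟩ : ∃ r, c ≤ r ∧ y ≤ r ∧ t - δ < r ∧ r < t := by
        obtain ⟨r, h1, h2⟩ := exists_between
          (max_lt (max_lt ht.1 hy) (by linarith : t - δ < t))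
        exact ⟨r, ((le_max_left _ _).trans (le_max_left _ _)).trans h1.le,
          ((le_max_right _ _).trans (le_max_left _ _)).trans h1.le,
          (le_max_right _ _).trans_lt h1, h2⟩
      refine ⟨r, ?_, hry, hrt⟩
      have hsub : Icc r t ⊆ Icc c b := Icc_subset_Icc hrc ht.2
      refine g.mem_futureTimelikeDomain_of_curve hS hrt (ν := fun t ↦ e.symm (f t)) ?_ ?_ htD
      · refine isTimelikeCurveOn_iff.2 fun q hq ↦ ?_
        have hqc : (f q, u' q + s • T) ∈ g.cone e.symm e.target := by
          refine hnear ⟨?_, hsub hq⟩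
          rw [Metric.mem_ball, Real.dist_eq, abs_lt]
          constructor <;> linarith [hq.1, hq.2]
        exact (isCurveAt_comp_iff_mem_cone (isOpen_extChartAt_target x)
          (contMDiffOn_extChartAt_symm_model x) ((hfC.mono hsub) q hq)
          ((hfd q (hsub hq)).mono hsub) (uniqueDiffOn_Icc hrt q hq) hqc.1).2 hqc
      · intro q hq
        exact (hft q (hsub hq)).2.2
  refine ⟨c, hc, fun t ht ↦ ?_⟩
  have hut : u t ∈ e.target := (hpush'' t ht).1.1.1.2.1
  -- `u` itself is only causal; it is reached as the limit `s → 0`, using that `D̃⁺(S)` is closed.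
  have hlim : Tendsto (fun s : ℝ ↦ e.symm (u t - (s * (b - t)) • T)) (𝓝[>] 0)
      (𝓝 (e.symm (u t))) := by
    have h1 : ContinuousAt e.symm (u t) :=
      (continuousOn_extChartAt_symm x).continuousAt ((isOpen_extChartAt_target x).mem_nhds hut)
    have h2 : Tendsto (fun s : ℝ ↦ u t - (s * (b - t)) • T) (𝓝 0) (𝓝 (u t)) := by
      have : Continuous (fun s : ℝ ↦ u t - (s * (b - t)) • T) := by fun_prop
      simpa using this.tendsto 0
    exact h1.tendsto.comp (h2.mono_left nhdsWithin_le_nhds)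
  refine (g.isClosed_futureTimelikeDomain hS).mem_of_tendsto hlim ?_
  filter_upwards [Ioo_mem_nhdsGT hs₀] with s hs
  exact hmain s hs.1 hs.2 t ht

end LorentzStructure

/-! ### Lifting curves through the isometry -/

/-- Inverse function theorem for a map from the model space to a manifold. -/
theorem exists_local_inverse_of_mfderiv_injective {n : ℕ} {N : Type*} [TopologicalSpace N]
    [ChartedSpace (EuclideanSpace ℝ (Fin n)) N] [IsManifold (𝓡 n) ∞ N]
    {F : EuclideanSpace ℝ (Fin n) → N} {x₀ : EuclideanSpace ℝ (Fin n)}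
    (hF : ContMDiffAt (𝓡 n) (𝓡 n) 1 F x₀)
    (hinj : ∀ v : EuclideanSpace ℝ (Fin n), mfderiv (𝓡 n) (𝓡 n) F x₀ v = 0 → v = 0) :
    ∃ Ψ : N → EuclideanSpace ℝ (Fin n), ContMDiffAt (𝓡 n) (𝓡 n) 1 Ψ (F x₀) ∧ Ψ (F x₀) = x₀ ∧
      (∀ᶠ z in 𝓝 (F x₀), F (Ψ z) = z) ∧ ∀ᶠ y in 𝓝 x₀, Ψ (F y) = y := by
  set e := extChartAt (𝓡 n) (F x₀) with he
  have hes : e.source ∈ 𝓝 (F x₀) := extChartAt_source_mem_nhds (I := 𝓡 n) (F x₀)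
  have heC : ContMDiffAt (𝓡 n) (𝓡 n) 1 e (F x₀) := contMDiffAt_extChartAt
  set G : EuclideanSpace ℝ (Fin n) → EuclideanSpace ℝ (Fin n) := fun y ↦ e (F y) with hG
  have hGC : ContDiffAt ℝ 1 G x₀ := by
    rw [← contMDiffAt_iff_contDiffAt]
    exact heC.comp x₀ hF
  have hGd : fderiv ℝ G x₀ = (mfderiv (𝓡 n) (𝓡 n) e (F x₀)).comp (mfderiv (𝓡 n) (𝓡 n) F x₀) := by
    rw [← mfderiv_eq_fderiv]
    exact mfderiv_comp x₀ (heC.mdifferentiableAt one_ne_zero) (hF.mdifferentiableAt one_ne_zero)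
  have hGi : ∀ v, fderiv ℝ G x₀ v = 0 → v = 0 := by
    intro v hv
    rw [hGd] at hv
    have h1 : Function.Injective (mfderiv (𝓡 n) (𝓡 n) e (F x₀)) :=
      (isInvertible_mfderiv_extChartAt (mem_extChartAt_source (F x₀))).bijective.injective
    exact hinj v (h1 (hv.trans (map_zero _).symm))
  have hGi' : Function.Injective (fderiv ℝ G x₀ :
      EuclideanSpace ℝ (Fin n) →ₗ[ℝ] EuclideanSpace ℝ (Fin n)) :=
    (injective_iff_map_eq_zero _).2 hGi
  set L := (LinearEquiv.ofInjectiveEndo _ hGi').toContinuousLinearEquiv with hL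
  have hLd : HasFDerivAt G (L : EuclideanSpace ℝ (Fin n) →L[ℝ] EuclideanSpace ℝ (Fin n)) x₀ := by
    have : (L : EuclideanSpace ℝ (Fin n) →L[ℝ] EuclideanSpace ℝ (Fin n)) = fderiv ℝ G x₀ := by
      ext v : 1
      rfl
    rw [this]
    exact (hGC.differentiableAt one_ne_zero).hasFDerivAt
  have hst := hGC.hasStrictFDerivAt' hLd one_ne_zero
  set Φ := hGC.localInverse hLd one_ne_zero with hΦ
  have hΦx : Φ (e (F x₀)) = x₀ := hGC.localInverse_apply_image hLd one_ne_zero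
  have hΦC : ContDiffAt ℝ 1 Φ (e (F x₀)) := hGC.to_localInverse hLd one_ne_zero
  have hΨC : ContMDiffAt (𝓡 n) (𝓡 n) 1 (fun z ↦ Φ (e z)) (F x₀) :=
    hΦC.contMDiffAt.comp (F x₀) heC
  refine ⟨fun z ↦ Φ (e z), hΨC, hΦx, ?_, hst.eventually_left_inverse⟩
  have h1 : ∀ᶠ z in 𝓝 (F x₀), G (Φ (e z)) = e z :=
    (continuousAt_extChartAt (F x₀)).eventually hst.eventually_right_inverse
  have h2 : ∀ᶠ z in 𝓝 (F x₀), F (Φ (e z)) ∈ e.source := by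
    have h3 : ContinuousAt (fun z ↦ F (Φ (e z))) (F x₀) := by
      refine ContinuousAt.comp (g := F) (f := fun z ↦ Φ (e z)) ?_ hΨC.continuousAt
      rw [hΦx]
      exact hF.continuousAt
    refine h3 ?_
    simp only [hΦx]
    exact hes
  filter_upwards [h1, h2, hes] with z hz1 hz2 hz3
  exact e.injOn hz2 hz3 hz1

namespace LorentzStructure

variable {n : ℕ} {M : Type*} [TopologicalSpace M]
  [ChartedSpace (EuclideanSpace ℝ (Fin n)) M] [IsManifold (𝓡 n) ∞ M]
  {N : Type*} [TopologicalSpace N]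
  [ChartedSpace (EuclideanSpace ℝ (Fin n)) N] [IsManifold (𝓡 n) ∞ N]

/-- The lift `(φ|_A)⁻¹ ∘ γ` of `γ` is defined at `t`, is a future directed causal curve there, and
its speed is that of `γ`. -/
def LiftAt (g : LorentzStructure n M) (h : LorentzStructure n N) [Nonempty M] (φ : M → N)
    (A : Set M) (γ : ℝ → N) (J : Set ℝ) (t : ℝ) : Prop :=
  γ t ∈ φ '' A ∧ IsCurveAt (fun x v ↦ g.FutureCausal x v ∧ g.metric x v v =
    h.metric (γ t) (mfderivWithin 𝓘(ℝ, ℝ) (𝓡 n) γ J t (1 : ℝ))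
      (mfderivWithin 𝓘(ℝ, ℝ) (𝓡 n) γ J t (1 : ℝ))) (fun s ↦ Function.invFunOn φ A (γ s)) J t

omit [IsManifold (𝓡 n) ∞ N] in
/-- The differential of `Φ ∘ e⁻¹` for a chart `e`, by the chain rule. -/
theorem mfderiv_comp_chart_symm {Φ : M → N} {U : Set M} (hU : IsOpen U)
    (hΦ : ContMDiffOn (𝓡 n) (𝓡 n) ∞ Φ U) (x : M) {y : EuclideanSpace ℝ (Fin n)}
    (hy : y ∈ (extChartAt (𝓡 n) x).target) (hyU : (extChartAt (𝓡 n) x).symm y ∈ U)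
    (v : EuclideanSpace ℝ (Fin n)) :
    mfderiv (𝓡 n) (𝓡 n) (fun z ↦ Φ ((extChartAt (𝓡 n) x).symm z)) y v =
      mfderiv (𝓡 n) (𝓡 n) Φ ((extChartAt (𝓡 n) x).symm y)
        (mfderiv (𝓡 n) (𝓡 n) (extChartAt (𝓡 n) x).symm y v) := by
  have h1 : MDifferentiableAt (𝓡 n) (𝓡 n) Φ ((extChartAt (𝓡 n) x).symm y) :=
    ((hΦ _ hyU).contMDiffAt (hU.mem_nhds hyU)).mdifferentiableAt (by simp)
  have h2 : MDifferentiableAt (𝓡 n) (𝓡 n) (extChartAt (𝓡 n) x).symm y :=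
    (((contMDiffOn_extChartAt_symm_model x) y hy).contMDiffAt
      ((isOpen_extChartAt_target x).mem_nhds hy)).mdifferentiableAt (by simp)
  have := mfderiv_comp y h1 h2
  exact DFunLike.congr_fun this v

theorem mfderiv_extChartAt_symm_injective (x : M) {y : EuclideanSpace ℝ (Fin n)}
    (hy : y ∈ (extChartAt (𝓡 n) x).target) {v : EuclideanSpace ℝ (Fin n)}
    (hv : mfderiv (𝓡 n) (𝓡 n) (extChartAt (𝓡 n) x).symm y v = 0) : v = 0 := by
  have h := isInvertible_mfderivWithin_extChartAt_symm hy
  rw [ModelWithCorners.range_eq_univ, mfderivWithin_univ] at h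
  exact h.bijective.injective (hv.trans (map_zero _).symm)

/-- If the pull-back of `h` under `F` at `y` is the metric `g` read in the chart, then the
differential of `F` is injective. -/
theorem mfderiv_injective_of_pullQuad_eq (g : LorentzStructure n M) (h : LorentzStructure n N)
    (x : M) {y : EuclideanSpace ℝ (Fin n)} (hy : y ∈ (extChartAt (𝓡 n) x).target)
    {F : EuclideanSpace ℝ (Fin n) → N}
    (hiso : ∀ v, h.pullQuad F (y, v) = g.pullQuad (extChartAt (𝓡 n) x).symm (y, v))
    {v : EuclideanSpace ℝ (Fin n)} (hv : mfderiv (𝓡 n) (𝓡 n) F y v = 0) : v = 0 := by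
  apply mfderiv_extChartAt_symm_injective x hy
  apply (g.isLorentzForm _).nondegenerate
  intro w
  obtain ⟨T, rfl⟩ := mfderiv_extChartAt_symm_surjective x hy w
  have h1 := h.pullQuad_polar F y v T
  rw [hv, hiso, hiso, hiso, ← g.pullQuad_polar] at h1
  have h2 : (2 : ℝ) * h.metric (F y) 0 (mfderiv (𝓡 n) (𝓡 n) F y T) = 0 := by simp
  rw [h2] at h1
  rw [form_apply]
  linarith

/-- If the lift of `γ` exists to the right of `t`, with limit `x ∈ D̃⁺(S) \ S` at `t` (or `t` is the
end of `γ`), then it exists also to the left of `t`. -/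
theorem exists_liftAt_left (g : LorentzStructure n M) (h : LorentzStructure n N) [Nonempty M]
    {S : Set M} (hS : IsClosed S) {φ : M → N} (hinj : InjOn φ (g.futureTimelikeDomain S))
    {a b : ℝ} {γ : ℝ → N} (hγ : h.IsCausalCurveOn γ (Ioc a b)) {t : ℝ} (ht : t ∈ Ioc a b)
    {x : M} (hxA : x ∈ g.futureTimelikeDomain S) (hxS : x ∉ S) (hxt : φ x = γ t)
    {U : Set M} {Φ : M → N} (hU : IsOpen U) (hxU : x ∈ U) (hΦ : ContMDiffOn (𝓡 n) (𝓡 n) ∞ Φ U)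
    (hΦφ : EqOn Φ φ (g.futureTimelikeDomain S ∩ U))
    (hΦiso : ∀ y ∈ g.futureTimelikeDomain S ∩ U, ∀ v w : TangentSpace (𝓡 n) y,
      h.metric (Φ y) (mfderiv (𝓡 n) (𝓡 n) Φ y v) (mfderiv (𝓡 n) (𝓡 n) Φ y w) = g.metric y v w)
    (hor : (t = b ∧ ∀ w : TangentSpace (𝓡 n) x,
        h.FutureCausal (Φ x) (mfderiv (𝓡 n) (𝓡 n) Φ x w) → g.metric x (g.timeField x) w < 0) ∨
      (t < b ∧ (∀ s ∈ Ioc t b, LiftAt g h φ (g.futureTimelikeDomain S) γ (Ioc a b) s) ∧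
        Tendsto (fun s ↦ Function.invFunOn φ (g.futureTimelikeDomain S) (γ s)) (𝓝[>] t) (𝓝 x))) :
    ∃ c ∈ Ico a t, ∀ s ∈ Ioc c t,
      LiftAt g h φ (g.futureTimelikeDomain S) γ (Ioc a b) s := by
  set A := g.futureTimelikeDomain S with hA
  set δ : ℝ → M := fun s ↦ Function.invFunOn φ A (γ s) with hδ
  have hab : a < b := ht.1.trans_le ht.2
  have hJu : UniqueDiffOn ℝ (Ioc a b) := uniqueDiffOn_Ioc a b
  have hδφ : ∀ s, ∀ y ∈ A, φ y = γ s → δ s = y := by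
    intro s y hy hys
    simp only [hδ, ← hys]
    exact hinj.leftInvOn_invFunOn hy
  have hxt0 : extChartAt (𝓡 n) x x ∈ (extChartAt (𝓡 n) x).target := mem_extChartAt_target x
  have hx0 : (extChartAt (𝓡 n) x).symm (extChartAt (𝓡 n) x x) = x := extChartAt_to_inv x
  have heo : IsOpen (extChartAt (𝓡 n) x).target := isOpen_extChartAt_target x
  have heC := contMDiffOn_extChartAt_symm_model (n := n) x
  have hΦe := fun y hy hyU v ↦ mfderiv_comp_chart_symm (n := n) hU hΦ x (y := y) hy hyU v
  have hFinj := fun (F : EuclideanSpace ℝ (Fin n) → N) hiso v ↦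
    mfderiv_injective_of_pullQuad_eq g h x hxt0 (F := F) hiso (v := v)
  have hlem := fun (W : Set (EuclideanSpace ℝ (Fin n))) hW hxW
    (F : EuclideanSpace ℝ (Fin n) → N) hF hiso u u' a' b' ↦
    g.eventually_mem_futureTimelikeDomain h hS hxA hxS (W := W) hW hxW (F := F) hF hiso
      (u := u) (u' := u') (a := a') (b := b')
  have hecont := continuousAt_extChartAt (I := 𝓡 n) x
  have hesrc := extChartAt_source_mem_nhds (I := 𝓡 n) x
  set e := extChartAt (𝓡 n) x with he
  set W := e.target ∩ e.symm ⁻¹' U with hW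
  have hWo : IsOpen W := heC.continuousOn.isOpen_inter_preimage heo hU
  have hxW : e x ∈ W := ⟨hxt0, by rwa [mem_preimage, hx0]⟩
  set F : EuclideanSpace ℝ (Fin n) → N := fun y ↦ Φ (e.symm y) with hF
  have hFC : ContMDiffOn (𝓡 n) (𝓡 n) ∞ F W :=
    hΦ.comp (heC.mono inter_subset_left) fun y hy ↦ hy.2
  have hFd : ∀ y ∈ W, ∀ v : EuclideanSpace ℝ (Fin n), mfderiv (𝓡 n) (𝓡 n) F y v =
      mfderiv (𝓡 n) (𝓡 n) Φ (e.symm y) (mfderiv (𝓡 n) (𝓡 n) e.symm y v) :=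
    fun y hy v ↦ hΦe y hy.1 hy.2 v
  have hiso : ∀ y ∈ W, e.symm y ∈ A → ∀ v, h.pullQuad F (y, v) = g.pullQuad e.symm (y, v) := by
    intro y hy hyA v
    simp only [pullQuad]
    rw [hFd y hy v]
    exact hΦiso _ ⟨hyA, hy.2⟩ _ _
  have hFx : F (e x) = γ t := by
    simp only [hF, hx0]
    rw [← hxt]
    exact hΦφ ⟨hxA, hxU⟩
  have hFx1 : ContMDiffAt (𝓡 n) (𝓡 n) 1 F (e x) :=
    ((hFC _ hxW).contMDiffAt (hWo.mem_nhds hxW)).of_le (by simp)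
  -- `Ψ` inverts the smooth extension, not `φ` itself, so `u = Ψ ∘ γ` is defined on both sides of
  -- `t` before it is known that `γ` stays in the image of `φ`.
  obtain ⟨Ψ, hΨ, hΨx, hΨr, hΨl⟩ := exists_local_inverse_of_mfderiv_injective hFx1
    (hFinj F (hiso _ hxW (by rwa [hx0])))
  rw [hFx] at hΨ hΨx hΨr
  obtain ⟨V₁, hV₁, hΨV₁⟩ := (contMDiffAt_iff_contMDiffOn_nhds (by simp)).1 hΨ
  have hΨW : Ψ ⁻¹' W ∈ 𝓝 (γ t) := by
    refine hΨ.continuousAt ?_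
    rw [hΨx]
    exact hWo.mem_nhds hxW
  have hV := (hγ.1.continuousOn t ht) (inter_mem hV₁ (inter_mem hΨr hΨW))
  rw [mem_map, mem_nhdsWithin] at hV
  obtain ⟨O, hO, htO, hOV⟩ := hV
  have htJO : t ∈ Ioc a b ∩ O := ⟨ht, htO⟩
  set u : ℝ → EuclideanSpace ℝ (Fin n) := fun s ↦ Ψ (γ s) with hu
  set u' : ℝ → EuclideanSpace ℝ (Fin n) := derivWithin u (Ioc a b) with hu'
  have huC : ContDiffOn ℝ 1 u (Ioc a b ∩ O) := by
    rw [← contMDiffOn_iff_contDiffOn]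
    exact hΨV₁.comp (hγ.1.mono inter_subset_left) fun s hs ↦ (hOV ⟨hs.2, hs.1⟩).1
  have huCs : ∀ s ∈ Ioc a b ∩ O, ContDiffWithinAt ℝ 1 u (Ioc a b) s := fun s hs ↦
    (contDiffWithinAt_inter (hO.mem_nhds hs.2)).1 (huC s hs)
  have hud : ∀ s ∈ Ioc a b ∩ O, HasDerivWithinAt u (u' s) (Ioc a b) s := fun s hs ↦
    ((huCs s hs).differentiableWithinAt one_ne_zero).hasDerivWithinAt
  have hu'C : ContinuousOn u' (Ioc a b ∩ O) :=
    (huC.continuousOn_derivWithin (hJu.inter hO) le_rfl).congr fun s hs ↦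
      (derivWithin_inter (hO.mem_nhds hs.2)).symm
  have huW : ∀ s ∈ Ioc a b ∩ O, u s ∈ W := fun s hs ↦ (hOV ⟨hs.2, hs.1⟩).2.2
  have hFu : ∀ s ∈ Ioc a b ∩ O, F (u s) = γ s := fun s hs ↦ (hOV ⟨hs.2, hs.1⟩).2.1
  have hux : u t = e x := hΨx
  -- the velocity of `u`
  have hvel : ∀ s ∈ Ioc a b ∩ O, h.FutureCausal (F (u s)) (mfderiv (𝓡 n) (𝓡 n) F (u s) (u' s)) ∧
      h.pullQuad F (u s, u' s) = h.metric (γ s) (mfderivWithin 𝓘(ℝ, ℝ) (𝓡 n) γ (Ioc a b) s (1 : ℝ))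
        (mfderivWithin 𝓘(ℝ, ℝ) (𝓡 n) γ (Ioc a b) s (1 : ℝ)) := by
    intro s hs
    have h1 : IsCurveAt (fun z v ↦ h.FutureCausal z v ∧ h.metric z v v =
        h.metric (γ s) (mfderivWithin 𝓘(ℝ, ℝ) (𝓡 n) γ (Ioc a b) s (1 : ℝ))
          (mfderivWithin 𝓘(ℝ, ℝ) (𝓡 n) γ (Ioc a b) s (1 : ℝ))) γ (Ioc a b) s :=
      ⟨hγ.1 s hs.1, hγ.2 s hs.1, rfl⟩
    have h2 : (fun s ↦ F (u s)) =ᶠ[𝓝[Ioc a b] s] γ := by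
      filter_upwards [self_mem_nhdsWithin, mem_nhdsWithin_of_mem_nhds (hO.mem_nhds hs.2)]
        with r hr1 hr2 using hFu r ⟨hr1, hr2⟩
    exact (isCurveAt_comp_iff hWo hFC (huCs s hs) (hud s hs) (hJu s hs.1) (huW s hs)).1
      (h1.congr h2 hs.1 EventuallyEq.rfl)
  have hne : ∀ s ∈ Ioc a b ∩ O, mfderiv (𝓡 n) (𝓡 n) e.symm (u s) (u' s) ≠ 0 := by
    intro s hs h0
    apply (hvel s hs).1.1
    exact (hFd _ (huW s hs) (u' s)).trans ((congrArg _ h0).trans (map_zero _))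
  have hQle : ∀ s ∈ Ioc a b ∩ O, h.pullQuad F (u s, u' s) ≤ 0 := fun s hs ↦ (hvel s hs).1.2.1
  have hcurve : ∀ s ∈ Ioc a b ∩ O, ∀ P : ∀ x : M, TangentSpace (𝓡 n) x → Prop,
      (IsCurveAt P (fun s ↦ e.symm (u s)) (Ioc a b) s ↔
        P (e.symm (u s)) (mfderiv (𝓡 n) (𝓡 n) e.symm (u s) (u' s))) := fun s hs P ↦
    isCurveAt_comp_iff heo heC (huCs s hs) (hud s hs) (hJu s hs.1) (huW s hs).1
  have htime : ContinuousOn (fun s ↦ g.pullTime e.symm (u s, u' s)) (Ioc a b ∩ O) :=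
    (g.continuousOn_pullTime heo heC).comp (huC.continuousOn.prodMk hu'C)
      fun s hs ↦ ⟨(huW s hs).1, trivial⟩
  -- to the right of `t`, the lift is `u` read in the chart
  have hright : ∀ᶠ s in 𝓝[>] t, s ∈ Ioc a b → δ s = e.symm (u s) := by
    rcases hor with ⟨rfl, -⟩ | ⟨htb, hlift, hlim⟩
    · filter_upwards [self_mem_nhdsWithin] with s hs1 hs2
      exact absurd hs2.2 (not_le.2 hs1)
    -- The lift tends to `x`, and near `x` applying `F` and then `Ψ` changes nothing; hence `u` and
    -- the lift coincide there.
    · have h1 : ∀ᶠ z in 𝓝 x, Ψ (F (e z)) = e z := hecont.eventually hΨl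
      filter_upwards [hlim.eventually h1, hlim.eventually (hU.mem_nhds hxU),
        hlim.eventually hesrc, Ioc_mem_nhdsGT htb] with s hs1 hs2 hs3 hs4 _
      obtain ⟨y, hyA, hys⟩ := (hlift s hs4).1
      have h2 : δ s = y := hδφ s y hyA hys
      have h3 : δ s ∈ A := by rwa [h2]
      have h4 : F (e (δ s)) = γ s := by
        simp only [hF]
        rw [e.left_inv hs3, hΦφ ⟨h3, hs2⟩, h2, hys]
      have h5 : u s = e (δ s) := by
        rw [← hs1, h4]
      rw [h5, e.left_inv hs3]
  -- At the end of `γ` the orientation is given. Elsewhere it is inherited from the right: the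
  -- pairing with the time field is a limit of negative numbers, and it is not `0` because a nonzero
  -- causal vector is never orthogonal to a timelike one.
  have horient : g.pullTime e.symm (u t, u' t) < 0 := by
    rcases hor with ⟨rfl, hor⟩ | ⟨htb, hlift, hlim⟩
    · have key : ∀ y, y = x → ∀ w : TangentSpace (𝓡 n) y,
          h.FutureCausal (Φ y) (mfderiv (𝓡 n) (𝓡 n) Φ y w) → g.metric y (g.timeField y) w < 0 := by
        rintro _ rfl
        exact hor
      have h1 := (hvel t htJO).1
      exact key _ (by rw [hux, hx0]) _ (Eq.mp (congrArg (h.FutureCausal (F (u t)))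
        (hFd _ (huW t htJO) (u' t))) h1)
    · have h1 : g.pullTime e.symm (u t, u' t) ≠ 0 := by
        refine (g.isLorentzForm _).pairing_ne_zero (g.timeField_timelike _) ?_ (hne t htJO)
        have := hQle t htJO
        rwa [hiso _ (huW t htJO) (by rwa [hux, hx0])] at this
      have h2 : ∀ᶠ s in 𝓝[>] t, g.pullTime e.symm (u s, u' s) ≤ 0 := by
        obtain ⟨r, hr, hrδ⟩ := mem_nhdsGT_iff_exists_Ioo_subset.1 hright
        filter_upwards [Ioo_mem_nhdsGT hr, Ioo_mem_nhdsGT htb,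
          mem_nhdsWithin_of_mem_nhds (hO.mem_nhds htO)] with s hs1 hs2 hs3
        have hsJ : s ∈ Ioc a b := ⟨ht.1.trans hs2.1, hs2.2.le⟩
        refine ((hcurve s ⟨hsJ, hs3⟩ _).1 ((hlift s ⟨hs2.1, hs2.2.le⟩).2.congr ?_ hsJ
          EventuallyEq.rfl)).1.2.2.le
        filter_upwards [self_mem_nhdsWithin, mem_nhdsWithin_of_mem_nhds (Ioo_mem_nhds hs1.1 hs1.2)]
          with q hq1 hq2
        exact (hrδ hq2 hq1).symm
      have h3 : Tendsto (fun s ↦ g.pullTime e.symm (u s, u' s)) (𝓝[>] t)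
          (𝓝 (g.pullTime e.symm (u t, u' t))) := by
        refine (htime t htJO).mono_left (nhdsWithin_le_iff.2 ?_)
        filter_upwards [Ioc_mem_nhdsGT htb, mem_nhdsWithin_of_mem_nhds (hO.mem_nhds htO)]
          with s hs1 hs2 using ⟨⟨ht.1.trans hs1.1, hs1.2⟩, hs2⟩
      exact lt_of_le_of_ne (le_of_tendsto h3 h2) h1
  -- the lift to the left of `t`
  obtain ⟨a', ha'a, ha't, ha'O⟩ : ∃ a', a < a' ∧ a' < t ∧ Icc a' t ⊆ O := by
    obtain ⟨r, hr, hrO⟩ := Metric.isOpen_iff.1 hO t htO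
    obtain ⟨a', h1, h2⟩ := exists_between (max_lt ht.1 (by linarith : t - r < t))
    refine ⟨a', (le_max_left _ _).trans_lt h1, h2, fun s hs ↦ hrO ?_⟩
    rw [Metric.mem_ball, Real.dist_eq, abs_lt]
    have := (le_max_right a (t - r)).trans_lt h1
    constructor <;> linarith [hs.1, hs.2]
  have hsub : Icc a' t ⊆ Ioc a b ∩ O := fun s hs ↦
    ⟨⟨ha'a.trans_le hs.1, hs.2.trans ht.2⟩, ha'O hs⟩
  obtain ⟨c, hc, hcA⟩ := hlem W hWo hxW F hFC hiso u u' a' t ha't (huC.mono hsub)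
    (fun s hs ↦ (hud s (hsub hs)).mono (hsub.trans inter_subset_left)) hux
    (fun s hs ↦ hQle s (hsub hs)) horient
  have hsub' : Icc c t ⊆ Ioc a b ∩ O := (Icc_subset_Icc_left hc.1).trans hsub
  have hδu : ∀ s ∈ Icc c t, δ s = e.symm (u s) := by
    intro s hs
    refine hδφ s _ (hcA s hs) ?_
    rw [← hΦφ ⟨hcA s hs, (huW s (hsub' hs)).2⟩]
    exact hFu s (hsub' hs)
  obtain ⟨c', hc', hcc', hneg⟩ : ∃ c', c' < t ∧ c ≤ c' ∧
      ∀ s ∈ Ioc c' t, g.pullTime e.symm (u s, u' s) < 0 := by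
    have h1 := (htime t htJO) (Iio_mem_nhds horient)
    rw [mem_map, Metric.mem_nhdsWithin_iff] at h1
    obtain ⟨r, hr, h1⟩ := h1
    refine ⟨max c (t - r), max_lt hc.2 (by linarith), le_max_left _ _, fun s hs ↦ h1 ⟨?_, ?_⟩⟩
    · rw [Metric.mem_ball, Real.dist_eq, abs_lt]
      have := (le_max_right c (t - r)).trans_lt hs.1
      constructor <;> linarith [hs.2]
    · exact hsub' ⟨(le_max_left _ _).trans hs.1.le, hs.2⟩
  refine ⟨c', ⟨?_, hc'⟩, fun s hs ↦ ?_⟩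
  · linarith [hc.1]
  · have hsc : s ∈ Icc c t := ⟨hcc'.trans hs.1.le, hs.2⟩
    have hsJO := hsub' hsc
    refine ⟨⟨e.symm (u s), hcA s hsc, ?_⟩, ?_⟩
    · rw [← hΦφ ⟨hcA s hsc, (huW s hsJO).2⟩]
      exact hFu s hsJO
    · have hQ := hiso _ (huW s hsJO) (hcA s hsc) (u' s)
      have h1 := (hcurve s hsJO (fun x v ↦ g.FutureCausal x v ∧ g.metric x v v =
        h.metric (γ s) (mfderivWithin 𝓘(ℝ, ℝ) (𝓡 n) γ (Ioc a b) s (1 : ℝ))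
          (mfderivWithin 𝓘(ℝ, ℝ) (𝓡 n) γ (Ioc a b) s (1 : ℝ)))).2
        ⟨⟨hne s hsJO, hQ.symm.trans_le (hQle s hsJO), hneg s hs⟩, hQ.symm.trans (hvel s hsJO).2⟩
      refine h1.congr ?_ hsJO.1 EventuallyEq.rfl
      have hleft : ∀ᶠ r in 𝓝[≤] t, δ r = e.symm (u r) := by
        filter_upwards [Icc_mem_nhdsLE hc.2] with r hr using hδu r hr
      -- At `s = t` the germ of the lift within `(a, b]` may also involve points to the right of
      -- `t`, so both one-sided descriptions are needed.
      rcases hs.2.eq_or_lt with rfl | hst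
      · have h2 : ∀ᶠ r in 𝓝 s, r ∈ Ioc a b → δ r = e.symm (u r) := by
          rw [← nhdsLE_sup_nhdsGT, eventually_sup]
          exact ⟨hleft.mono fun r hr _ ↦ hr, hright⟩
        exact eventually_nhdsWithin_iff.2 h2
      · filter_upwards [mem_nhdsWithin_of_mem_nhds (Icc_mem_nhds (hcc'.trans_lt hs.1) hst)]
          with r hr using hδu r hr

theorem isCausalCurveOn_of_isTimelikeCurveOn {g : LorentzStructure n M} {γ : ℝ → M} {J : Set ℝ}
    (hγ : g.IsTimelikeCurveOn γ J) : g.IsCausalCurveOn γ J := by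
  refine ⟨hγ.1, fun t ht ↦ ⟨fun h0 ↦ ?_, (hγ.2 t ht).1.le, (hγ.2 t ht).2⟩⟩
  have := (hγ.2 t ht).2
  rw [h0, map_zero] at this
  exact lt_irrefl _ this

/-- Lift under `φ` of a past inextendible causal curve that ends at the image of a point
of `D̃⁺(S) \ S` and avoids `φ(S)`. -/
theorem exists_inextendible_lift [T2Space N] (g : LorentzStructure n M) (h : LorentzStructure n N)
    {S : Set M} (hS : IsClosed S) {φ : M → N}
    (hφ : g.IsIsometryOn h φ (g.futureTimelikeDomain S)) {p : M}
    (hp : p ∈ g.futureTimelikeDomain S) {U : Set M} {Φ : M → N} (hU : IsOpen U) (hpU : p ∈ U)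
    (hΦ : ContMDiffOn (𝓡 n) (𝓡 n) ∞ Φ U) (hΦφ : EqOn Φ φ (g.futureTimelikeDomain S ∩ U))
    (hΦiso : ∀ y ∈ g.futureTimelikeDomain S ∩ U, ∀ v w : TangentSpace (𝓡 n) y,
      h.metric (Φ y) (mfderiv (𝓡 n) (𝓡 n) Φ y v) (mfderiv (𝓡 n) (𝓡 n) Φ y w) = g.metric y v w)
    (hor : h.metric (Φ p) (h.timeField (Φ p)) (mfderiv (𝓡 n) (𝓡 n) Φ p (g.timeField p)) < 0)
    {a b : ℝ} (hab : a < b) {γ : ℝ → N} (hγ : h.IsCausalCurveOn γ (Ioc a b))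
    (hγa : PastInextendible γ a) (hγb : γ b = φ p) (hγS : ∀ t ∈ Ioc a b, γ t ∉ φ '' S) :
    ∃ (c : ℝ) (δ : ℝ → M), c < b ∧ a ≤ c ∧ g.IsCausalCurveOn δ (Ioc c b) ∧
      PastInextendible δ c ∧ δ b = p ∧ (∀ t ∈ Ioc c b, φ (δ t) = γ t) ∧
      (h.IsTimelikeCurveOn γ (Ioc a b) → g.IsTimelikeCurveOn δ (Ioc c b)) := by
  have hM : Nonempty M := ⟨p⟩
  obtain ⟨hinj, hloc⟩ := hφ
  set A := g.futureTimelikeDomain S with hA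
  set δ : ℝ → M := fun s ↦ Function.invFunOn φ A (γ s) with hδ
  have hbI : b ∈ Ioc a b := right_mem_Ioc.2 hab
  have hSφ : ∀ x, ∀ t ∈ Ioc a b, φ x = γ t → x ∉ S := fun x t ht hx hxS ↦
    hγS t ht ⟨x, hxS, hx⟩
  obtain ⟨c₀, hc₀, hlift₀⟩ := exists_liftAt_left g h hS hinj hγ hbI hp (hSφ p b hbI hγb.symm)
    hγb.symm hU hpU hΦ hΦφ hΦiso <| by
      refine Or.inl ⟨rfl, fun w hw ↦ ?_⟩
      -- The image of the time field is future timelike, so it pairs negatively with every future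
      -- causal vector; the isometry carries this inequality back to `p`.
      have h1 : h.metric (Φ p) (mfderiv (𝓡 n) (𝓡 n) Φ p (g.timeField p))
          (mfderiv (𝓡 n) (𝓡 n) Φ p w) < 0 := by
        refine (h.isLorentzForm (Φ p)).same_orientation (h.timeField_timelike _) ?_ hor hw.2.1
          hw.1 hw.2.2
        rw [form_apply, hΦiso p ⟨hp, hpU⟩]
        exact g.timeField_timelike p
      rwa [hΦiso p ⟨hp, hpU⟩] at h1
  -- The lift is given by one formula on all of these intervals, so it is a curve on their union
  -- `(c, b]`, where `c` is the infimum.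
  set Z : Set ℝ := {t | a ≤ t ∧ t < b ∧ ∀ s ∈ Ioc t b, LiftAt g h φ A γ (Ioc a b) s} with hZ
  have hZ₀ : c₀ ∈ Z := ⟨hc₀.1, hc₀.2, hlift₀⟩
  have hZb : BddBelow Z := ⟨a, fun t ht ↦ ht.1⟩
  set c := sInf Z with hc
  have hac : a ≤ c := le_csInf ⟨_, hZ₀⟩ fun t ht ↦ ht.1
  have hcb : c < b := (csInf_le hZb hZ₀).trans_lt hc₀.2
  have hlift : ∀ s ∈ Ioc c b, LiftAt g h φ A γ (Ioc a b) s := by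
    intro s hs
    obtain ⟨t, ht, hts⟩ := exists_lt_of_csInf_lt ⟨_, hZ₀⟩ hs.1
    exact ht.2.2 s ⟨hts, hs.2⟩
  have hδA : ∀ s ∈ Ioc c b, δ s ∈ A := fun s hs ↦ Function.invFunOn_mem (hlift s hs).1
  have hδφ : ∀ s ∈ Ioc c b, φ (δ s) = γ s := fun s hs ↦ Function.invFunOn_eq (hlift s hs).1
  have hJ : ∀ s ∈ Ioc c b, Ioc c b =ᶠ[𝓝 s] Ioc a b := by
    intro s hs
    filter_upwards [Ioi_mem_nhds hs.1] with r (hr : c < r)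
    exact propext ⟨fun h ↦ ⟨hac.trans_lt h.1, h.2⟩, fun h ↦ ⟨hr, h.2⟩⟩
  have hδC := fun s (hs : s ∈ Ioc c b) ↦ (hlift s hs).2.congr EventuallyEq.rfl hs (hJ s hs)
  have hδc : g.IsCausalCurveOn δ (Ioc c b) :=
    isCausalCurveOn_iff.2 fun s hs ↦ ⟨(hδC s hs).1, (hδC s hs).2.1⟩
  refine ⟨c, δ, hcb, hac, hδc, ?_, ?_, hδφ, fun hγt ↦ isTimelikeCurveOn_iff.2 fun s hs ↦
    ⟨(hδC s hs).1, ?_, (hδC s hs).2.1.2.2⟩⟩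
  · rintro ⟨x, hx⟩
    have hev : ∀ᶠ s in 𝓝[>] c, s ∈ Ioc c b := Ioc_mem_nhdsGT hcb
    have hxA : x ∈ A := (g.isClosed_futureTimelikeDomain hS).mem_of_tendsto hx (hev.mono hδA)
    obtain ⟨U', Φ', hU', hxU', hΦ', hΦφ', hΦiso'⟩ := hloc x hxA
    have hγx : Tendsto γ (𝓝[>] c) (𝓝 (φ x)) := by
      rw [← hΦφ' ⟨hxA, hxU'⟩]
      have h1 : Tendsto Φ' (𝓝 x) (𝓝 (Φ' x)) :=
        (hΦ'.continuousOn.continuousAt (hU'.mem_nhds hxU')).tendsto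
      refine (h1.comp hx).congr' ?_
      filter_upwards [hev, hx.eventually (hU'.mem_nhds hxU')] with s hs1 hs2
      rw [Function.comp_apply, hΦφ' ⟨hδA s hs1, hs2⟩, hδφ s hs1]
    rcases hac.eq_or_lt with hac' | hac'
    · exact hγa ⟨φ x, hac' ▸ hγx⟩
    · have hcI : c ∈ Ioc a b := ⟨hac', hcb.le⟩
      have h1 : Tendsto γ (𝓝[>] c) (𝓝 (γ c)) := by
        refine (hγ.1.continuousOn c hcI).mono_left (nhdsWithin_le_iff.2 ?_)
        filter_upwards [hev] with s hs using ⟨hac.trans_lt hs.1, hs.2⟩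
      have hxc : φ x = γ c := tendsto_nhds_unique hγx h1
      obtain ⟨c₁, hc₁, hlift₁⟩ := exists_liftAt_left g h hS hinj hγ hcI hxA (hSφ x c hcI hxc)
        hxc hU' hxU' hΦ' hΦφ' hΦiso' (Or.inr ⟨hcb, hlift, hx⟩)
      have : c₁ ∈ Z := by
        refine ⟨hc₁.1, hc₁.2.trans hcb, fun s hs ↦ ?_⟩
        rcases le_or_gt s c with h2 | h2
        · exact hlift₁ s ⟨hs.1, h2⟩
        · exact hlift s ⟨h2, hs.2⟩
      exact absurd (csInf_le hZb this) (not_le.2 hc₁.2)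
  · simp only [hδ, hγb]
    exact hinj.leftInvOn_invFunOn hp
  -- This is the purpose of the speed clause in `LiftAt`: the lift of a timelike curve is timelike.
  · rw [(hδC s hs).2.2]
    exact (hγt.2 s ⟨hac.trans_lt hs.1, hs.2⟩).1

/-! ### Time reversal -/

/-- The same metric with the opposite time orientation. -/
noncomputable def reverse (g : LorentzStructure n M) : LorentzStructure n M where
  metric := g.metric
  symm := g.symm
  signature := g.signature
  smooth := g.smooth
  timeField := fun x ↦ -g.timeField x
  timeField_continuous := by
    have h1 : ContMDiff (𝓡 n) (𝓡 n).tangent 0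
        (fun x ↦ (⟨x, g.timeField x⟩ : TangentBundle (𝓡 n) M)) :=
      contMDiff_zero_iff.2 g.timeField_continuous
    exact contMDiff_zero_iff.1 h1.neg_section
  timeField_timelike := fun x ↦ by
    simpa using g.timeField_timelike x

theorem reverse_metric (g : LorentzStructure n M) : g.reverse.metric = g.metric := rfl

theorem reverse_timeField (g : LorentzStructure n M) (x : M) :
    g.reverse.timeField x = -g.timeField x := rfl

theorem reverse_reverse (g : LorentzStructure n M) : g.reverse.reverse = g := by
  cases g
  simp [reverse]

theorem futureTimelike_neg (g : LorentzStructure n M) {x : M} {v : TangentSpace (𝓡 n) x}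
    (hv : g.FutureTimelike x v) : g.reverse.FutureTimelike x ((-1 : ℝ) • v) := by
  refine ⟨?_, ?_⟩
  · simpa [reverse_metric] using hv.1
  · simpa [reverse_metric, reverse_timeField] using hv.2

theorem futureCausal_neg (g : LorentzStructure n M) {x : M} {v : TangentSpace (𝓡 n) x}
    (hv : g.FutureCausal x v) : g.reverse.FutureCausal x ((-1 : ℝ) • v) := by
  refine ⟨?_, ?_, ?_⟩
  · simpa using hv.1
  · simpa [reverse_metric] using hv.2.1
  · simpa [reverse_metric, reverse_timeField] using hv.2.2

omit [IsManifold (𝓡 n) ∞ M] in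
theorem isCurveAt_neg {P Q : ∀ x : M, TangentSpace (𝓡 n) x → Prop}
    (hPQ : ∀ x v, P x v → Q x ((-1 : ℝ) • v)) {γ : ℝ → M} {J J' : Set ℝ} (hJ' : UniqueDiffOn ℝ J')
    (hJ : ∀ t ∈ J', -t ∈ J) (hγ : ∀ t ∈ J, IsCurveAt P γ J t) :
    ∀ t ∈ J', IsCurveAt Q (fun s ↦ γ (-s)) J' t := by
  intro t ht
  have h1 := hγ (-t) (hJ t ht)
  have h2 : IsCurveAt (fun x v ↦ Q x ((-1 : ℝ) • v)) γ J (-1 * t + 0) := by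
    rw [show -1 * t + 0 = -t by ring]
    exact ⟨h1.1, hPQ _ _ h1.2⟩
  have h3 := h2.comp_affine (hJ' t ht) (fun s hs ↦ by simpa using hJ s hs)
  simpa using h3

end LorentzStructure

namespace LorentzStructure

section Reverse

variable {n : ℕ} {M : Type*} [TopologicalSpace M] [ChartedSpace (EuclideanSpace ℝ (Fin n)) M]

omit [ChartedSpace (EuclideanSpace ℝ (Fin n)) M] in
theorem PastInextendible.neg {γ : ℝ → M} {a : ℝ} (h : PastInextendible γ a) :
    FutureInextendible (fun s ↦ γ (-s)) (-a) := by
  rintro ⟨x, hx⟩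
  exact h ⟨x, by simpa [Function.comp_def] using hx.comp tendsto_neg_nhdsGT⟩

omit [ChartedSpace (EuclideanSpace ℝ (Fin n)) M] in
theorem FutureInextendible.neg {γ : ℝ → M} {a : ℝ} (h : FutureInextendible γ a) :
    PastInextendible (fun s ↦ γ (-s)) (-a) := by
  rintro ⟨x, hx⟩
  exact h ⟨x, by simpa [Function.comp_def] using hx.comp tendsto_neg_nhdsLT⟩

/-- The substitution `t ↦ -t` exchanges the two kinds of inextendible curves and negates velocities.
Abstract predicates let one argument serve both the causal and the timelike domains. -/
theorem past_iff_future_of_neg {P Q : ∀ x : M, TangentSpace (𝓡 n) x → Prop}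
    (hPQ : ∀ x v, P x v → Q x ((-1 : ℝ) • v)) (hQP : ∀ x v, Q x v → P x ((-1 : ℝ) • v))
    (S : Set M) (p : M) :
    (∀ (a b : ℝ) (γ : ℝ → M), a < b → (∀ t ∈ Ico a b, IsCurveAt P γ (Ico a b) t) →
      FutureInextendible γ b → γ a = p → ∃ t ∈ Ico a b, γ t ∈ S) ↔
    (∀ (a b : ℝ) (γ : ℝ → M), a < b → (∀ t ∈ Ioc a b, IsCurveAt Q γ (Ioc a b) t) →
      PastInextendible γ a → γ b = p → ∃ t ∈ Ioc a b, γ t ∈ S) := by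
  constructor
  · intro h a b γ hab hγ hγa hγb
    obtain ⟨t, ht, htS⟩ := h (-b) (-a) (fun s ↦ γ (-s)) (by linarith)
      (isCurveAt_neg (J := Ioc a b) hQP (uniqueDiffOn_Ico _ _)
        (fun t ht ↦ ⟨by linarith [ht.2], by linarith [ht.1]⟩) hγ) hγa.neg (by simpa using hγb)
    exact ⟨-t, ⟨by linarith [ht.2], by linarith [ht.1]⟩, htS⟩
  · intro h a b γ hab hγ hγa hγb
    obtain ⟨t, ht, htS⟩ := h (-b) (-a) (fun s ↦ γ (-s)) (by linarith)
      (isCurveAt_neg (J := Ico a b) hPQ (uniqueDiffOn_Ioc _ _)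
        (fun t ht ↦ ⟨by linarith [ht.2], by linarith [ht.1]⟩) hγ) hγa.neg (by simpa using hγb)
    exact ⟨-t, ⟨by linarith [ht.2], by linarith [ht.1]⟩, htS⟩

variable [IsManifold (𝓡 n) ∞ M]

theorem pastDomain_eq (g : LorentzStructure n M) (S : Set M) :
    g.pastDomain S = g.reverse.futureDomain S := by
  ext p
  have := past_iff_future_of_neg (P := g.FutureCausal) (Q := g.reverse.FutureCausal)
    (fun x v ↦ g.futureCausal_neg)
    (fun x v hv ↦ by simpa only [reverse_reverse] using g.reverse.futureCausal_neg hv) S p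
  simp only [← isCausalCurveOn_iff] at this
  simpa only [pastDomain, futureDomain, mem_ofPred_eq, isCausalCurveOn_iff] using this

theorem pastTimelikeDomain_eq (g : LorentzStructure n M) (S : Set M) :
    g.pastTimelikeDomain S = g.reverse.futureTimelikeDomain S := by
  ext p
  have := past_iff_future_of_neg (P := g.FutureTimelike) (Q := g.reverse.FutureTimelike)
    (fun x v ↦ g.futureTimelike_neg)
    (fun x v hv ↦ by simpa only [reverse_reverse] using g.reverse.futureTimelike_neg hv) S p
  simpa only [pastTimelikeDomain, futureTimelikeDomain, mem_ofPred_eq, isTimelikeCurveOn_iff]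
    using this

theorem futureDomain_subset (g : LorentzStructure n M) (S : Set M) :
    g.futureDomain S ⊆ g.futureTimelikeDomain S := fun _ hp a b γ hab hγ ↦
  hp a b γ hab (isCausalCurveOn_of_isTimelikeCurveOn hγ)

end Reverse

/-! ### Conclusion: the four choices of time orientation -/

variable {n : ℕ} {M : Type*} [TopologicalSpace M]
  [ChartedSpace (EuclideanSpace ℝ (Fin n)) M] [IsManifold (𝓡 n) ∞ M]
  {N : Type*} [TopologicalSpace N]
  [ChartedSpace (EuclideanSpace ℝ (Fin n)) N] [IsManifold (𝓡 n) ∞ N]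

theorem IsIsometryOn.mono {g : LorentzStructure n M} {h : LorentzStructure n N} {φ : M → N}
    {A A' : Set M} (hφ : g.IsIsometryOn h φ A) (hA : A' ⊆ A) : g.IsIsometryOn h φ A' := by
  refine ⟨hφ.1.mono hA, fun x hx ↦ ?_⟩
  obtain ⟨U, Φ, hU, hxU, hΦ, hΦφ, hiso⟩ := hφ.2 x (hA hx)
  exact ⟨U, Φ, hU, hxU, hΦ, hΦφ.mono (inter_subset_inter_left _ hA),
    fun y hy ↦ hiso y ⟨hA hy.1, hy.2⟩⟩

/-- Isometries that preserve the time orientation at `p` map `p ∈ D⁺(S)` into `D⁺(φ(S))`, and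
likewise for `D̃⁺`. -/
theorem mem_futureDomain_of_oriented [T2Space N] (g : LorentzStructure n M)
    (h : LorentzStructure n N) {S : Set M} (hS : IsClosed S) {φ : M → N}
    (hφ : g.IsIsometryOn h φ (g.futureTimelikeDomain S)) {p : M}
    (hp : p ∈ g.futureTimelikeDomain S) {U : Set M} {Φ : M → N} (hU : IsOpen U) (hpU : p ∈ U)
    (hΦ : ContMDiffOn (𝓡 n) (𝓡 n) ∞ Φ U) (hΦφ : EqOn Φ φ (g.futureTimelikeDomain S ∩ U))
    (hΦiso : ∀ y ∈ g.futureTimelikeDomain S ∩ U, ∀ v w : TangentSpace (𝓡 n) y,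
      h.metric (Φ y) (mfderiv (𝓡 n) (𝓡 n) Φ y v) (mfderiv (𝓡 n) (𝓡 n) Φ y w) = g.metric y v w)
    (hor : h.metric (Φ p) (h.timeField (Φ p)) (mfderiv (𝓡 n) (𝓡 n) Φ p (g.timeField p)) < 0) :
    φ p ∈ h.futureTimelikeDomain (φ '' S) ∧
      (p ∈ g.futureDomain S → φ p ∈ h.futureDomain (φ '' S)) := by
  constructor
  · intro a b γ hab hγ hγa hγb
    by_contra! hγS
    obtain ⟨c, δ, hcb, hac, -, hδc, hδb, hδφ, hδt⟩ := exists_inextendible_lift g h hS hφ hp hU hpU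
      hΦ hΦφ hΦiso hor hab (isCausalCurveOn_of_isTimelikeCurveOn hγ) hγa hγb hγS
    obtain ⟨t, ht, htS⟩ := hp c b δ hcb (hδt hγ) hδc hδb
    exact hγS t ⟨hac.trans_lt ht.1, ht.2⟩ ⟨δ t, htS, hδφ t ht⟩
  · intro hp' a b γ hab hγ hγa hγb
    by_contra! hγS
    obtain ⟨c, δ, hcb, hac, hδ, hδc, hδb, hδφ, -⟩ := exists_inextendible_lift g h hS hφ hp hU hpU
      hΦ hΦφ hΦiso hor hab hγ hγa hγb hγS
    obtain ⟨t, ht, htS⟩ := hp' c b δ hcb hδ hδc hδb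
    exact hγS t ⟨hac.trans_lt ht.1, ht.2⟩ ⟨δ t, htS, hδφ t ht⟩

/-- The differential at `p` sends the time field to a timelike vector, which is future or past
directed. In the second case the time orientation of `N` is reversed, and the image of `p` lands in
the past domain instead; hence the unions in the conclusion. -/
theorem mem_domainOfDependence_of_future [T2Space N] (g : LorentzStructure n M)
    (h : LorentzStructure n N) {S : Set M} (hS : IsClosed S) {φ : M → N}
    (hφ : g.IsIsometryOn h φ (g.futureTimelikeDomain S)) {p : M}
    (hp : p ∈ g.futureTimelikeDomain S) :
    φ p ∈ h.timelikeDomainOfDependence (φ '' S) ∧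
      (p ∈ g.futureDomain S → φ p ∈ h.domainOfDependence (φ '' S)) := by
  obtain ⟨U, Φ, hU, hpU, hΦ, hΦφ, hiso⟩ := hφ.2 p hp
  set w := mfderiv (𝓡 n) (𝓡 n) Φ p (g.timeField p) with hw
  have hww : h.metric (Φ p) w w < 0 := by
    rw [hw, hiso p ⟨hp, hpU⟩]
    exact g.timeField_timelike p
  have hw0 : w ≠ 0 := by
    intro h0
    rw [h0, map_zero] at hww
    exact lt_irrefl _ hww
  have hne : h.metric (Φ p) (h.timeField (Φ p)) w ≠ 0 :=
    (h.isLorentzForm (Φ p)).pairing_ne_zero (h.timeField_timelike _) hww.le hw0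
  unfold timelikeDomainOfDependence domainOfDependence
  rcases hne.lt_or_gt with hor | hor
  · have := mem_futureDomain_of_oriented g h hS hφ hp hU hpU hΦ hΦφ hiso hor
    exact ⟨Or.inl this.1, fun hp' ↦ Or.inl (this.2 hp')⟩
  · have := mem_futureDomain_of_oriented g h.reverse hS hφ hp hU hpU hΦ hΦφ hiso (by
      rw [reverse_metric, reverse_timeField]
      simpa using hor)
    rw [← pastDomain_eq, ← pastTimelikeDomain_eq] at this
    exact ⟨Or.inr this.1, fun hp' ↦ Or.inr (this.2 hp')⟩

end LorentzStructure

theorem mainTheorem5 {n : ℕ} (hn : 2 ≤ n)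
    {M : Type*} [TopologicalSpace M] [ChartedSpace (EuclideanSpace ℝ (Fin n)) M]
    [IsManifold (𝓡 n) ∞ M] [T2Space M] [ConnectedSpace M]
    {N : Type*} [TopologicalSpace N] [ChartedSpace (EuclideanSpace ℝ (Fin n)) N]
    [IsManifold (𝓡 n) ∞ N] [T2Space N] [ConnectedSpace N]
    (g : LorentzStructure n M) (h : LorentzStructure n N)
    (S : Set M) (hSclosed : IsClosed S) (hSachronal : g.IsAchronal S)
    (φ : M → N) (hφ : g.IsIsometryOn h φ (g.timelikeDomainOfDependence S)) :
    φ '' g.domainOfDependence S ⊆ h.domainOfDependence (φ '' S) ∧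
      φ '' g.timelikeDomainOfDependence S ⊆ h.timelikeDomainOfDependence (φ '' S) := by
  have h1 : g.IsIsometryOn h φ (g.futureTimelikeDomain S) := hφ.mono subset_union_left
  -- Reversing time in `M` turns the past half of the domain into a future half, so each half is
  -- treated by the same lemma.
  have h2 : g.reverse.IsIsometryOn h φ (g.reverse.futureTimelikeDomain S) := by
    rw [← g.pastTimelikeDomain_eq]
    exact hφ.mono subset_union_right
  constructor
  · rintro _ ⟨p, hp | hp, rfl⟩
    · exact (g.mem_domainOfDependence_of_future h hSclosed h1 (g.futureDomain_subset S hp)).2 hp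
    · rw [g.pastDomain_eq] at hp
      exact (g.reverse.mem_domainOfDependence_of_future h hSclosed h2
        (g.reverse.futureDomain_subset S hp)).2 hp
  · rintro _ ⟨p, hp | hp, rfl⟩
    · exact (g.mem_domainOfDependence_of_future h hSclosed h1 hp).1
    · rw [g.pastTimelikeDomain_eq] at hp
      exact (g.reverse.mem_domainOfDependence_of_future h hSclosed h2 hp).1
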